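/- Let $n\ge 3$ be an integer and let $G$ be a finitely generated torsion-free nilpotent group of cohomological dimension $k<n$; that is, $H^i(G;A)=0$ for every $i>k$ and every $\mathbb{Z}G$-module $A$, while $H^k(G;M)\neq 0$ for some $\mathbb{Z}G$-module $M$. Let $\mathrm{Out}(G)=\mathrm{Aut}(G)/\mathrm{Inn}(G)$ be the outer automorphism group of $G$, and let $\mathrm{St}_n(\mathbb{Z})$ be the Steinberg group, that is, the group generated by symbols $x_{ij}(r)$ ($1\le i\neq j\le n$, $r\in\mathbb{Z}$) subject to the relations \begin{enumerate} \item $x_{ij}(r)\,x_{ij}(s)=x_{ij}(r+s)$; \item $[x_{ij}(r),x_{jk}(s)]=x_{ik}(rs)$ if $i\neq k$; \item $[x_{ij}(r),x_{pq}(s)]=1$ if $j\neq p$ and $i\neq q$, \end{enumerate} where $[a,b]=aba^{-1}b^{-1}$. Then every group homomorphism $\mathrm{St}_n(\mathbb{Z})\to\mathrm{Out}(G)$ is trivial, and hence every group homomorphism $\mathrm{SL}_n(\mathbb{Z})\to\mathrm{Out}(G)$ is trivial. -/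

import Mathlib

universe u v

/-- The symbol `x_{ij}(r)`, for `i ≠ j`, in the free group on all such symbols. -/
abbrev steinbergGen {n : ℕ} {R : Type v} (i j : Fin n) (hij : i ≠ j) (r : R) :
    FreeGroup ({p : Fin n × Fin n // p.1 ≠ p.2} × R) :=
  FreeGroup.of (⟨(i, j), hij⟩, r)

/-- The relators of the Steinberg group `St_n(R)`, in the free group on the symbols `x_{ij}(r)` with
`i ≠ j` and `r ∈ R`. Commutators are `[a, b] = a b a⁻¹ b⁻¹`. -/
inductive SteinbergRel (n : ℕ) (R : Type v) [Ring R] :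
    FreeGroup ({p : Fin n × Fin n // p.1 ≠ p.2} × R) → Prop
  /-- `x_{ij}(r) x_{ij}(s) = x_{ij}(r + s)` -/
  | add (i j : Fin n) (hij : i ≠ j) (r s : R) :
      SteinbergRel n R
        (steinbergGen i j hij r * steinbergGen i j hij s * (steinbergGen i j hij (r + s))⁻¹)
  /-- `[x_{ij}(r), x_{jk}(s)] = x_{ik}(r s)` for `i ≠ k` -/
  | comm_mul (i j k : Fin n) (hij : i ≠ j) (hjk : j ≠ k) (hik : i ≠ k) (r s : R) :
      SteinbergRel n R
        (steinbergGen i j hij r * steinbergGen j k hjk s *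
          (steinbergGen i j hij r)⁻¹ * (steinbergGen j k hjk s)⁻¹ * (steinbergGen i k hik (r * s))⁻¹)
  /-- `[x_{ij}(r), x_{pq}(s)] = 1` for `j ≠ p` and `i ≠ q` -/
  | comm_one (i j p q : Fin n) (hij : i ≠ j) (hpq : p ≠ q) (hjp : j ≠ p) (hiq : i ≠ q) (r s : R) :
      SteinbergRel n R
        (steinbergGen i j hij r * steinbergGen p q hpq s *
          (steinbergGen i j hij r)⁻¹ * (steinbergGen p q hpq s)⁻¹)

/-- The Steinberg group `St_n(R)`. -/
abbrev SteinbergGroup (n : ℕ) (R : Type v) [Ring R] : Type v :=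
  PresentedGroup {w | SteinbergRel n R w}

/-- The subgroup `Inn(G)` of inner automorphisms. -/
abbrev innerAut (G : Type u) [Group G] : Subgroup (MulAut G) :=
  (MulAut.conj : G →* MulAut G).range

instance innerAut_normal (G : Type u) [Group G] : (innerAut G).Normal where
  conj_mem := by
    rintro _ ⟨g, rfl⟩ φ
    exact ⟨φ g, by ext x; simp [MulAut.conj_apply]⟩

/-- The outer automorphism group `Out(G) = Aut(G) / Inn(G)`. -/
abbrev OuterAut (G : Type u) [Group G] : Type u :=
  MulAut G ⧸ innerAut G

/-- `G` has cohomological dimension `k`: `H^i(G; A) = 0` for all `i > k` and all `ℤG`-modules `A`,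
and `H^k(G; M) ≠ 0` for some `ℤG`-module `M`. The ring of integers is lifted to the universe of `G`
because group cohomology is defined for a coefficient ring in that universe. -/
def HasCohomologicalDimension (G : Type u) [Group G] (k : ℕ) : Prop :=
  (∀ (A : Rep.{u} (ULift.{u} ℤ) G) (i : ℕ), k < i →
      CategoryTheory.Limits.IsZero (groupCohomology A i)) ∧
    ∃ M : Rep.{u} (ULift.{u} ℤ) G, ¬ CategoryTheory.Limits.IsZero (groupCohomology M k)

/-! The cohomological dimension enters only as an upper bound for a Hirsch length. Let `Z` be the
centre of `G`; it is free abelian of some rank `r`, and `G ⧸ Z` is again finitely generated,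
torsion-free and nilpotent. Adding up these ranks along repeated central quotients gives a number
`h`, and two inductions over the same quotients prove the theorem.

First, `Ext^h(ℤ, ℤG) ≠ 0`, whence `h ≤ k < n`. Each infinite cyclic central subgroup `⟨z⟩` raises
the degree by one: multiplication by `z - 1` on `ℤG` is injective with cokernel `ℤ[G/⟨z⟩]`, and
Rees' change of rings (`subsingleton_ext_of_subsingleton_ext_succ`) carries nonvanishing from degree
`i` for the quotient to degree `i + 1` for `G`.

Second, `St_n(ℤ) → Out(G)` is trivial whenever `h < n`. Such a map induces maps to `Out(G ⧸ Z)`,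
trivial by induction, and to `Aut(Z) = GL_r(ℤ)` with `r < n`, trivial because `St_n(ℤ)` has no
nontrivial representation of dimension below `n` (`SteinbergGroup.hom_end_eq_one`). The image
therefore lies in the kernel of `Out(G) → Out(G ⧸ Z) × Aut(Z)`, which is abelian, while `St_n(ℤ)` is
perfect.

The representation theorem has two halves. An eigenvalue other than `1` of a generator would produce
`n` distinct weights for a commuting row of generators, so the generators are unipotent; unipotent
systems are then killed by induction on the index set, through the fixed space of one row. The
statement for `SL_n(ℤ)` follows since it is generated by transvections, the images of the Steinberg
generators. -/

/-! ### Homological algebra: change of rings for Ext. -/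

section Rees

open CategoryTheory Limits Abelian

variable {C : Type*} [Category* C] [Abelian C] [HasExt.{v} C] [EnoughProjectives C]

/-- A natural endomorphism of the identity functor which vanishes on `M` acts as zero
on `Ext¹(M, Y)`. -/
lemma ext_one_comp_app_eq_zero (θ : 𝟭 C ⟶ 𝟭 C) {M : C} (hM : θ.app M = 0) (Y : C)
    (α : Abelian.Ext.{v} M Y 1) : α.comp (Ext.mk₀ (θ.app Y)) (add_zero 1) = 0 := by
  let P : ProjectivePresentation M := Classical.arbitrary _
  have := P.projective
  let S := ShortComplex.mk _ _ (kernel.condition P.f)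
  have hS : S.ShortExact := { exact := ShortComplex.exact_kernel P.f }
  have : Subsingleton (Abelian.Ext.{v} S.X₂ Y 1) := Ext.subsingleton_of_projective _ _ 0
  obtain ⟨β, rfl⟩ := Ext.contravariant_sequence_exact₃ hS Y α (Subsingleton.elim _ _) (add_zero 1)
  obtain ⟨f, rfl⟩ := (Ext.mk₀_bijective _ _).2 β
  -- Since `θ` is zero on `M`, it maps the projective `P.p` into the kernel, so `θ` on the kernel
  -- extends to `P.p`. If `f` represents the class, `f ≫ θ.app Y` then extends too and represents
  -- zero.
  have h1 : θ.app P.p ≫ P.f = 0 := by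
    have := θ.naturality P.f
    simp only [Functor.id_obj, Functor.id_map] at this
    rw [← this, hM, comp_zero]
  let w : P.p ⟶ S.X₁ := kernel.lift P.f (θ.app P.p) h1
  have hw : S.f ≫ w = θ.app S.X₁ := by
    have h2 : w ≫ S.f = θ.app P.p := kernel.lift_ι _ _ _
    have : Mono S.f := hS.mono_f
    rw [← cancel_mono S.f, Category.assoc, h2]
    exact θ.naturality S.f
  have hf : f ≫ θ.app Y = S.f ≫ w ≫ f := by
    rw [← Category.assoc, hw]
    exact θ.naturality f
  rw [Ext.comp_assoc _ _ _ (by simp) (add_zero 0) (by simp), Ext.mk₀_comp_mk₀, hf,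
    ← Ext.mk₀_comp_mk₀ (S.f), ← Ext.comp_assoc _ _ _ (add_zero 1) (add_zero 0) (by simp),
    hS.extClass_comp, Ext.zero_comp]

variable {D : Type*} [Category* D] [Abelian D] [HasExt.{v} D]

/-- The Rees change of rings, in the form of a vanishing statement: let `F : D ⥤ C` be exact and fully
faithful, and let `θ` be an endomorphism of the identity functor of `C` which vanishes on the image
of `F`. If `θ` is a monomorphism on `Y` with cokernel `F.obj Y'`, then the vanishing of
`Ext^{i+1}(F M, Y)` implies that of `Ext^i(M, Y')`. -/
theorem subsingleton_ext_of_subsingleton_ext_succ (F : D ⥤ C) [F.Additive] [F.Full] [F.Faithful]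
    [PreservesFiniteLimits F] [PreservesFiniteColimits F]
    (θ : 𝟭 C ⟶ 𝟭 C) (hθ : ∀ M : D, θ.app (F.obj M) = 0)
    (hP : ∀ M : D, ∃ (P : D) (p : P ⟶ M), Projective P ∧ Epi p ∧
      HasProjectiveDimensionLT (F.obj P) 2)
    {Y : C} {Y' : D} (q : Y ⟶ F.obj Y') (w : θ.app Y ≫ q = 0)
    (hS : (ShortComplex.mk (θ.app Y) q w).ShortExact) (i : ℕ) (M : D)
    (h : Subsingleton (Abelian.Ext.{v} (F.obj M) Y (i + 1))) :
    Subsingleton (Abelian.Ext.{v} M Y' i) := by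
  have hmono : Mono (θ.app Y) := hS.mono_f
  -- By naturality `θ` is both zero and injective on the image of such an `f`. Consequently the
  -- connecting map `Hom(F M, F Y') → Ext¹(F M, Y)` is injective, which is `hinj`.
  have hom_zero (M : D) (f : F.obj M ⟶ Y) : f = 0 := by
    rw [← cancel_mono (θ.app Y), zero_comp]
    have := θ.naturality f
    simp only [Functor.id_obj, Functor.id_map] at this
    rw [this, hθ, zero_comp]
  have hinj (M : D) (f : F.obj M ⟶ F.obj Y')
      (hf : (Ext.mk₀ f).comp hS.extClass (zero_add 1) = 0) : f = 0 := by
    obtain ⟨x, hx⟩ := Ext.covariant_sequence_exact₃ _ hS (Ext.mk₀ f) (zero_add 1) hf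
    obtain ⟨g, rfl⟩ := (Ext.mk₀_bijective _ _).2 x
    obtain rfl := hom_zero M g
    rw [Ext.mk₀_comp_mk₀] at hx
    rw [← (Ext.mk₀_bijective _ _).1 hx, zero_comp]
  induction i using Nat.strong_induction_on generalizing M with
  | _ i ih =>
  match i with
  | 0 =>
    refine ⟨fun a b => ?_⟩
    suffices h0 : ∀ a : Abelian.Ext.{v} M Y' 0, a = 0 by rw [h0 a, h0 b]
    intro a
    obtain ⟨f, rfl⟩ := (Ext.mk₀_bijective _ _).2 a
    have : F.map f = 0 := hinj M _
      (Subsingleton.elim (α := Abelian.Ext.{v} (F.obj M) Y 1) _ _)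
    rw [F.map_injective (this.trans (F.map_zero _ _).symm), Ext.mk₀_zero]
  | j + 1 =>
    obtain ⟨P, p, _, _, hPd⟩ := hP M
    let T := ShortComplex.mk _ _ (kernel.condition p)
    have hT : T.ShortExact := { exact := ShortComplex.exact_kernel p }
    have hFT : (T.map F).ShortExact := hT.map_of_exact F
    refine ⟨fun a b => ?_⟩
    suffices h0 : ∀ a : Abelian.Ext.{v} M Y' (j + 1), a = 0 by rw [h0 a, h0 b]
    intro a
    have : Subsingleton (Abelian.Ext.{v} P Y' (j + 1)) := Ext.subsingleton_of_projective _ _ j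
    obtain ⟨β, rfl⟩ := Ext.contravariant_sequence_exact₃ hT Y' (n₀ := j) a
      (Subsingleton.elim (α := Abelian.Ext.{v} P Y' (j + 1)) _ _) (add_comm 1 j)
    match j with
    | 0 =>
      obtain ⟨f, rfl⟩ := (Ext.mk₀_bijective _ _).2 β
      -- Degree one cannot be shifted, because `Ext¹(F P, Y)` need not vanish. Instead `γ` extends
      -- to a class `δ` on `F P`; `θ` kills `δ`, so `δ` comes from a map `F P ⟶ F Y'`, and by
      -- fullness and `hinj` that map is an extension of `f` to `P`.
      let γ : Abelian.Ext.{v} (F.obj T.X₁) Y 1 := (Ext.mk₀ (F.map f)).comp hS.extClass (zero_add 1)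
      obtain ⟨δ, hδ⟩ := Ext.contravariant_sequence_exact₁ hFT Y γ (n₁ := 2) rfl
        (Subsingleton.elim (α := Abelian.Ext.{v} (F.obj M) Y 2) _ _)
      obtain ⟨ε, hε⟩ := Ext.covariant_sequence_exact₁ _ hS δ
        (ext_one_comp_app_eq_zero θ (hθ P) Y δ) (zero_add 1)
      obtain ⟨g, rfl⟩ := (Ext.mk₀_bijective _ _).2 ε
      obtain ⟨g, rfl⟩ := F.map_surjective g
      have key : F.map f = F.map (T.f ≫ g) := by
        rw [← sub_eq_zero]
        refine hinj _ _ ?_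
        rw [sub_eq_add_neg, Ext.mk₀_add, Ext.mk₀_neg, Ext.add_comp, Ext.neg_comp, ← sub_eq_add_neg,
          sub_eq_zero, F.map_comp, ← Ext.mk₀_comp_mk₀,
          Ext.comp_assoc _ _ _ (add_zero 0) (zero_add 1) (by simp)]
        exact (hδ.symm.trans (by rw [← hε]; rfl))
      rw [F.map_injective key, ← Ext.mk₀_comp_mk₀,
        ← Ext.comp_assoc _ _ _ (add_zero 1) (add_zero 0) (by simp), hT.extClass_comp,
        Ext.zero_comp]
    | l + 1 =>
      -- In higher degrees ordinary dimension shifting works: `F P` has projective dimension at most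
      -- one, so its Ext vanishes from degree `2 ≤ l + 2` on.
      have : Subsingleton (Abelian.Ext.{v} T.X₁ Y' (l + 1)) := by
        refine ih (l + 1) (by omega) T.X₁ ⟨fun a b => ?_⟩
        suffices h0 : ∀ a : Abelian.Ext.{v} (F.obj T.X₁) Y (l + 2), a = 0 by rw [h0 a, h0 b]
        intro a
        obtain ⟨x, hx⟩ := Ext.contravariant_sequence_exact₁ hFT Y a (n₁ := l + 3) (by omega)
          (Subsingleton.elim (α := Abelian.Ext.{v} (F.obj M) Y (l + 3)) _ _)
        have : Subsingleton (Abelian.Ext.{v} (F.obj P) Y (l + 2)) :=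
          HasProjectiveDimensionLT.subsingleton _ 2 _ (by omega) _
        obtain rfl : x = 0 := Subsingleton.elim (α := Abelian.Ext.{v} (F.obj P) Y (l + 2)) x 0
        exact hx.symm.trans (Ext.comp_zero _ _ _ _ _)
      rw [Subsingleton.elim β 0, Ext.comp_zero]

end Rees

/-! ### Group algebras and quotients by a central cyclic subgroup. -/

section GroupRing

open CategoryTheory Limits Abelian

instance Rep.hasExt (k G : Type u) [CommRing k] [Group G] : HasExt.{u} (Rep.{u} k G) :=
  hasExt_of_enoughProjectives.{u} _

/-- The natural endomorphism `ρ(z) - 1` of representations, for a central element `z`. -/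
def Rep.centralSubOne (k : Type u) {G : Type u} [CommRing k] [Group G] (z : G)
    (hz : z ∈ Subgroup.center G) : 𝟭 (Rep.{u} k G) ⟶ 𝟭 (Rep.{u} k G) where
  app A := Rep.ofHom ⟨A.ρ z - 1, fun g => by
    have := (Subgroup.mem_center_iff.1 hz g)
    ext x
    have h2 := congrArg (fun t => A.ρ t x) this
    simp only [map_mul, Module.End.mul_apply] at h2
    simp [h2]⟩
  naturality A B f := by
    ext x
    simp [Rep.hom_comm_apply]

/-- The projection of free representations induced by a group homomorphism. -/
noncomputable def Rep.freeMap (k : Type u) {G Q : Type u} [CommRing k] [Group G] [Group Q] (π : G →* Q)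
    (α : Type u) : Rep.free k G α ⟶ (Rep.resFunctor π).obj (Rep.free k Q α) :=
  Rep.ofHom ⟨Finsupp.mapRange.linearMap (MonoidAlgebra.mapDomainAlgHom k k π).toLinearMap, fun g => by
    ext a h : 3
    simp⟩

section Exactness

variable {k : Type u} {G Q : Type u} [CommRing k] [Group G] [Group Q]

/-- Left multiplication by `z - 1` on the group algebra. -/
noncomputable def MonoidAlgebra.mulSubOne (k : Type u) [CommRing k] (z : G) :
    MonoidAlgebra k G →ₗ[k] MonoidAlgebra k G :=
  Representation.leftRegular k G z - LinearMap.id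

/-- An element fixed by `z` has coefficients constant along the infinite sets `{z ^ n * g}`, which
contradicts finite support unless they all vanish. -/
lemma MonoidAlgebra.mulSubOne_injective {z : G} (hz : ¬ IsOfFinOrder z) :
    Function.Injective (MonoidAlgebra.mulSubOne k z) := by
  rw [injective_iff_map_eq_zero]
  intro x hx
  have hx' : Representation.leftRegular k G z x = x := by
    simpa [sub_eq_zero, mulSubOne] using hx
  have hc (g : G) : x.coeff (z * g) = x.coeff g := by
    conv_lhs => rw [← hx']
    simp
  have hpow (n : ℕ) (g : G) : x.coeff (z ^ n * g) = x.coeff g := by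
    induction n with
    | zero => simp
    | succ n ih => rw [pow_succ', mul_assoc, hc, ih]
  ext g
  by_contra hg
  have hinf : Function.Injective fun n : ℕ => z ^ n * g := fun a b h =>
    (injective_pow_iff_not_isOfFinOrder.2 hz) (mul_right_cancel h)
  refine (Set.infinite_range_of_injective hinf) (x.coeff.support.finite_toSet.subset ?_)
  rintro _ ⟨n, rfl⟩
  simpa [hpow] using hg

/-- Modulo the image of `z - 1`, a basis element depends only on its coset of `⟨z⟩`, by telescoping
over powers of `z`. Every `y` is thus congruent to the lift of its image in `kQ` along a fixed
section. -/
lemma MonoidAlgebra.exact_mulSubOne (π : G →* Q) (hπ : Function.Surjective π) (z : G)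
    (hker : π.ker = Subgroup.zpowers z) :
    Function.Exact (MonoidAlgebra.mulSubOne k z)
      (MonoidAlgebra.mapDomainAlgHom k k π).toLinearMap := by
  have hπz : π z = 1 := by
    have : z ∈ π.ker := hker ▸ Subgroup.mem_zpowers z
    exact this
  intro x
  constructor
  · intro hx
    have key : ∀ y : MonoidAlgebra k G, y - (MonoidAlgebra.mapDomain (Function.surjInv hπ)
        (MonoidAlgebra.mapDomain π y)) ∈ LinearMap.range (MonoidAlgebra.mulSubOne k z) := by
      intro y
      induction y using MonoidAlgebra.induction_linear with
      | zero => simp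
      | add f g hf hg =>
        have := add_mem hf hg
        rw [MonoidAlgebra.mapDomain_add, MonoidAlgebra.mapDomain_add]
        convert this using 1
        abel
      | single g r =>
        rw [MonoidAlgebra.mapDomain_single, MonoidAlgebra.mapDomain_single]
        have hg' : g * (Function.surjInv hπ (π g))⁻¹ ∈ π.ker := by
          rw [MonoidHom.mem_ker, map_mul, map_inv, Function.surjInv_eq hπ (π g), mul_inv_cancel]
        generalize Function.surjInv hπ (π g) = g' at *
        rw [hker] at hg'
        obtain ⟨n, hn⟩ := hg'
        obtain rfl : g = z ^ n * g' := by simp [hn]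
        have hstep (m : ℤ) : MonoidAlgebra.single (z ^ (m + 1) * g') r -
            MonoidAlgebra.single (z ^ m * g') r ∈ LinearMap.range (MonoidAlgebra.mulSubOne k z) := by
          refine ⟨MonoidAlgebra.single (z ^ m * g') r, ?_⟩
          simp [mulSubOne, add_comm m, zpow_one_add, mul_assoc]
        clear hn
        induction n with
        | zero => simp
        | succ n ih =>
          rw [← sub_add_sub_cancel _ (MonoidAlgebra.single (z ^ (n : ℤ) * g') r)]
          exact add_mem (hstep n) ih
        | pred n ih =>
          have h1 := hstep (-(n : ℤ) - 1)
          rw [sub_add_cancel] at h1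
          simpa using sub_mem ih h1
    have h := key x
    have hx' : MonoidAlgebra.mapDomain π x = 0 := hx
    rw [hx', MonoidAlgebra.mapDomain_zero, sub_zero] at h
    simpa using h
  · rintro ⟨y, rfl⟩
    induction y using MonoidAlgebra.induction_linear with
    | zero => simp
    | add f g hf hg => rw [map_add, map_add, hf, hg, add_zero]
    | single g r =>
      rw [mulSubOne, LinearMap.sub_apply, map_sub]
      simp [hπz]

lemma Rep.free_apply_apply (α : Type u) (g : G) (x : α →₀ MonoidAlgebra k G) (a : α) :
    Representation.free k G α g x a = Representation.leftRegular k G g (x a) := by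
  induction x using Finsupp.induction_linear with
  | zero => simp
  | add f g hf hg => rw [map_add, Finsupp.add_apply, hf, hg, Finsupp.add_apply, map_add]
  | single b y =>
    classical
    simp only [Representation.finsupp_single, Finsupp.single_apply]
    split_ifs <;> simp

lemma Rep.free_shortExact (π : G →* Q) (hπ : Function.Surjective π) (z : G)
    (hz : z ∈ Subgroup.center G) (hz' : ¬ IsOfFinOrder z)
    (hker : π.ker = Subgroup.zpowers z) (α : Type u) :
    ∃ w : (Rep.centralSubOne k z hz).app (Rep.free k G α) ≫ Rep.freeMap k π α = 0,
      (ShortComplex.mk ((Rep.centralSubOne k z hz).app (Rep.free k G α)) (Rep.freeMap k π α)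
        w).ShortExact := by
  let f : (α →₀ MonoidAlgebra k G) →ₗ[k] (α →₀ MonoidAlgebra k G) :=
    ((Rep.centralSubOne k z hz).app (Rep.free k G α)).hom.toLinearMap
  let g : (α →₀ MonoidAlgebra k G) →ₗ[k] (α →₀ MonoidAlgebra k Q) :=
    (Rep.freeMap k π α).hom.toLinearMap
  have happ (x : α →₀ MonoidAlgebra k G) (a : α) : f x a = MonoidAlgebra.mulSubOne k z (x a) :=
    congrArg (· - x a) (Rep.free_apply_apply α z x a)
  have hmap (x : α →₀ MonoidAlgebra k G) (a : α) :
      g x a = (MonoidAlgebra.mapDomainAlgHom k k π).toLinearMap (x a) := rfl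
  have hex := MonoidAlgebra.exact_mulSubOne (k := k) π hπ z hker
  have hinj : Function.Injective f := fun x y h => Finsupp.ext fun a =>
    MonoidAlgebra.mulSubOne_injective hz' (by rw [← happ, ← happ, h])
  have hsurj : Function.Surjective g :=
    Finsupp.mapRange_surjective _ (map_zero _) fun y => by
      obtain ⟨x, hx⟩ := Finsupp.mapDomain_surjective hπ y.coeff
      exact ⟨.ofCoeff x, congrArg MonoidAlgebra.ofCoeff hx⟩
  have hfg : Function.Exact f g := by
    intro x
    constructor
    · intro hx
      have h (a : α) : ∃ y, MonoidAlgebra.mulSubOne k z y = x a :=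
        (hex (x a)).1 (by rw [← hmap, hx]; rfl)
      choose y hy using h
      -- The coordinatewise preimages have finite support because `z - 1` is injective: where `x` is
      -- zero, so is `y`.
      refine ⟨Finsupp.onFinset x.support y fun a ha => ?_, Finsupp.ext fun a => ?_⟩
      · rw [Finsupp.mem_support_iff]
        rintro h0
        exact ha (MonoidAlgebra.mulSubOne_injective hz' (by rw [hy, h0, map_zero]))
      · rw [happ, Finsupp.onFinset_apply, hy]
    · rintro ⟨y, rfl⟩
      refine Finsupp.ext fun a => ?_
      rw [hmap, happ]
      exact hex.apply_apply_eq_zero _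
  have w : (Rep.centralSubOne k z hz).app (Rep.free k G α) ≫ Rep.freeMap k π α = 0 :=
    Rep.hom_ext (Representation.IntertwiningMap.ext
      (LinearMap.ext fun x => hfg.apply_apply_eq_zero x))
  refine ⟨w, ?_⟩
  have : Mono ((Rep.centralSubOne k z hz).app (Rep.free k G α)) :=
    (Rep.mono_iff_injective _).2 hinj
  have : Epi (Rep.freeMap k π α) := (Rep.epi_iff_surjective _).2 hsurj
  refine ShortComplex.ShortExact.mk ?_
  rw [← ShortComplex.exact_map_iff_of_faithful _ (forget₂ (Rep.{u} k G) (ModuleCat.{u} k)),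
    ShortComplex.ShortExact.moduleCat_exact_iff_function_exact]
  exact hfg

end Exactness

end GroupRing

/-! ### Nonvanishing of Ext with coefficients in the group ring. -/

section RegularExt

open CategoryTheory Limits Abelian

variable {k : Type u} {G Q : Type u} [CommRing k] [Group G] [Group Q]

/-- Both groups are computed by the standard resolution: an Ext class is represented by a cocycle,
which is a coboundary by hypothesis. -/
lemma groupCohomology_subsingleton_ext (A : Rep.{u} k G) (n : ℕ)
    (h : IsZero (groupCohomology A (n + 1))) :
    Subsingleton (Abelian.Ext.{u} (Rep.trivial k G k) A (n + 1)) := by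
  let P := Rep.standardResolution k G
  have hz : IsZero ((P.complex.linearYonedaObj k A).homology (n + 1)) :=
    h.of_iso (groupCohomologyIso A (n + 1) P).symm
  rw [← HomologicalComplex.exactAt_iff_isZero_homology,
    HomologicalComplex.exactAt_iff' _ n (n + 1) (n + 2) (by simp) (by simp),
    ShortComplex.moduleCat_exact_iff] at hz
  refine ⟨fun a b => ?_⟩
  suffices h0 : ∀ a : Abelian.Ext.{u} (Rep.trivial k G k) A (n + 1), a = 0 by rw [h0 a, h0 b]
  intro a
  obtain ⟨f, hf, rfl⟩ := P.extMk_surjective a (n + 2) rfl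
  rw [P.extMk_eq_zero_iff _ _ _ _ n rfl]
  obtain ⟨g, hg⟩ := hz f hf
  exact ⟨g, hg⟩

/-- The group `Ext^i_{kG}(k, kG)` is nonzero. -/
def RegularExtNontrivial (k G : Type u) [CommRing k] [Group G] (i : ℕ) : Prop :=
  Nontrivial (Abelian.Ext.{u} (Rep.trivial k G k) (Rep.free k G PUnit.{u + 1}) i)

/-- The contrapositive is Rees' change of rings for restriction along `π`, with `θ` the action of `z
- 1`. A free `Q`-representation becomes, over `G`, the cokernel of `z - 1` on a free one, and so has
projective dimension at most one. -/
lemma RegularExtNontrivial.of_ker_eq_zpowers (π : G →* Q) (hπ : Function.Surjective π) (z : G)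
    (hz : z ∈ Subgroup.center G) (hz' : ¬ IsOfFinOrder z)
    (hker : π.ker = Subgroup.zpowers z) {i : ℕ} (h : RegularExtNontrivial k Q i) :
    RegularExtNontrivial k G (i + 1) := by
  by_contra hG
  have := Rep.full_res (k := k) π hπ
  obtain ⟨w, hw⟩ := Rep.free_shortExact (k := k) π hπ z hz hz' hker PUnit.{u + 1}
  refine not_nontrivial_iff_subsingleton.2 ?_ h
  refine subsingleton_ext_of_subsingleton_ext_succ (Rep.resFunctor.{u} (k := k) π)
    (Rep.centralSubOne k z hz) (fun M => ?_) (fun M => ?_) _ w hw i _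
    (not_nontrivial_iff_subsingleton.1 hG)
  · have hπz : π z = 1 := by
      have : z ∈ π.ker := hker ▸ Subgroup.mem_zpowers z
      exact this
    refine Rep.hom_ext (Representation.IntertwiningMap.ext (LinearMap.ext fun x => ?_))
    change M.ρ (π z) x - (show M.V from x) = 0
    rw [hπz, map_one]
    exact sub_self (G := M.V) x
  · refine ⟨Rep.free k Q M.V, Rep.freeLift k Q M id,
      Rep.free_projective.{u, u, u} (k := k) (G := Q) (α := M.V), ?_, ?_⟩
    · rw [Rep.epi_iff_surjective]
      intro x
      refine ⟨Finsupp.single x (MonoidAlgebra.single 1 1), ?_⟩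
      simp
    · obtain ⟨w', hw'⟩ := Rep.free_shortExact (k := k) π hπ z hz hz' hker M.V
      have : Projective ((𝟭 _).obj (Rep.free k G M.V)) :=
        Rep.free_projective.{u, u, u} (k := k) (G := G) (α := M.V)
      exact hw'.hasProjectiveDimensionLT_X₃ 1 inferInstance inferInstance

lemma RegularExtNontrivial.zero_of_subsingleton [Nontrivial k] [Subsingleton G] :
    RegularExtNontrivial k G 0 := by
  let f : Rep.trivial k G k ⟶ Rep.free k G PUnit.{u + 1} :=
    Rep.ofHom ⟨(Finsupp.lsingle PUnit.unit).comp
      (Algebra.linearMap k (MonoidAlgebra k G)), fun g => by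
      obtain rfl : g = 1 := Subsingleton.elim _ _
      ext; simp⟩
  have hf : f ≠ 0 := by
    intro h
    have h1 : f.hom (1 : k) = 0 := by rw [h]; rfl
    have h2 : Finsupp.single PUnit.unit (algebraMap k (MonoidAlgebra k G) 1) = 0 := h1
    rw [Finsupp.single_eq_zero, map_one] at h2
    exact one_ne_zero h2
  exact ⟨⟨Ext.mk₀ f, 0, fun h => hf ((Ext.mk₀_bijective _ _).1 (h.trans (Ext.mk₀_zero _ _).symm))⟩⟩

/-- The integer lattice `ℤ^r`, written multiplicatively. -/
abbrev MulLattice (r : ℕ) : Type := Multiplicative (Fin r → ℤ)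

/-- The lattice is peeled off one coordinate at a time: with `Z` generated by the image of the first
basis vector, `G ⧸ Z` is a central extension of `Q` by a lattice of rank one less. -/
lemma RegularExtNontrivial.of_ker_eq_range {i : ℕ} (h : RegularExtNontrivial k Q i) (r : ℕ) :
    ∀ {G : Type u} [Group G] (π : G →* Q) (_ : Function.Surjective π)
      (ι : MulLattice (r + 1) →* G) (_ : Function.Injective ι) (_ : π.ker = ι.range)
      (_ : ι.range ≤ Subgroup.center G), RegularExtNontrivial k G (i + (r + 1)) := by
  induction r with
  | zero =>
    intro G _ π hπ ι hι hker hcen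
    let e : MulLattice 1 := Multiplicative.ofAdd 1
    refine h.of_ker_eq_zpowers π hπ (ι e) (hcen ⟨_, rfl⟩) ?_ ?_
    · rw [← injective_pow_iff_not_isOfFinOrder]
      intro a b hab
      simp only [← map_pow] at hab
      have := congrFun (congrArg Multiplicative.toAdd (hι hab)) 0
      simpa [e] using this
    · rw [hker]
      ext x
      rw [MonoidHom.mem_range, Subgroup.mem_zpowers_iff]
      constructor
      · rintro ⟨v, rfl⟩
        refine ⟨v.toAdd 0, ?_⟩
        rw [← map_zpow]
        congr 1
        apply Multiplicative.toAdd.injective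
        funext j
        obtain rfl : j = 0 := Fin.fin_one_eq_zero j
        simp [e]
      · rintro ⟨n, rfl⟩
        exact ⟨e ^ n, map_zpow _ _ _⟩
  | succ r ih =>
    intro G _ π hπ ι hι hker hcen
    let e : MulLattice (r + 2) := Multiplicative.ofAdd (Pi.single 0 1)
    have hez (n : ℤ) : (e ^ n).toAdd = Pi.single 0 n := by
      simp [e, ← Pi.single_smul]
    have hec : ι e ∈ Subgroup.center G := hcen ⟨_, rfl⟩
    let Z := Subgroup.zpowers (ι e)
    have : Z.Normal := ⟨fun n hn g => by
      have : n ∈ Subgroup.center G := (Subgroup.zpowers_le.2 hec) hn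
      rwa [Subgroup.mem_center_iff.1 this g, mul_inv_cancel_right]⟩
    have hZ : Z ≤ π.ker := by
      rw [hker]
      exact Subgroup.zpowers_le.2 ⟨_, rfl⟩
    let π₁ : G ⧸ Z →* Q := QuotientGroup.lift Z π hZ
    let c : MulLattice (r + 1) →* MulLattice (r + 2) :=
      AddMonoidHom.toMultiplicative
        { toFun := fun v => Fin.cons 0 v
          map_zero' := by ext j; refine Fin.cases ?_ (fun _ => ?_) j <;> simp
          map_add' := fun v w => by ext j; refine Fin.cases ?_ (fun _ => ?_) j <;> simp }
    have hc (v) : (c v).toAdd = Fin.cons 0 v.toAdd := rfl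
    let ι₁ : MulLattice (r + 1) →* G ⧸ Z := (QuotientGroup.mk' Z).comp (ι.comp c)
    have hdec (v : MulLattice (r + 2)) : ∃ (w : _) (n : ℤ), v = c w * e ^ n := by
      refine ⟨Multiplicative.ofAdd fun j => v.toAdd j.succ, v.toAdd 0, ?_⟩
      apply Multiplicative.toAdd.injective
      rw [toAdd_mul, hez, hc]
      ext j
      refine Fin.cases ?_ (fun _ => ?_) j <;> simp
    have hG1 : RegularExtNontrivial k (G ⧸ Z) (i + (r + 1)) := by
      refine ih π₁ (QuotientGroup.lift_surjective_of_surjective _ _ hπ _) ι₁ ?_ ?_ ?_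
      · rw [injective_iff_map_eq_one]
        intro v hv
        have hv' : ι (c v) ∈ Z := (QuotientGroup.eq_one_iff _).1 hv
        obtain ⟨n, hn⟩ := hv'
        have h1 := congrArg Multiplicative.toAdd (hι ((map_zpow ι e n).trans hn))
        rw [hez, hc] at h1
        apply Multiplicative.toAdd.injective
        ext j
        have := congrFun h1 j.succ
        simpa using this.symm
      · ext x
        obtain ⟨g, rfl⟩ := QuotientGroup.mk_surjective x
        have h1 : (g : G ⧸ Z) ∈ π₁.ker ↔ g ∈ ι.range := by
          rw [← hker]; rfl
        rw [h1]
        constructor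
        · rintro ⟨v, rfl⟩
          obtain ⟨w, n, rfl⟩ := hdec v
          refine ⟨w, ?_⟩
          change ((ι (c w) : G) : G ⧸ Z) = _
          rw [QuotientGroup.eq, map_mul, inv_mul_cancel_left, map_zpow]
          exact ⟨n, rfl⟩
        · rintro ⟨w, hw⟩
          change ((ι (c w) : G) : G ⧸ Z) = _ at hw
          rw [QuotientGroup.eq] at hw
          obtain ⟨n, hn⟩ := hw
          refine ⟨c w * e ^ n, ?_⟩
          rw [map_mul, map_zpow]
          simp only at hn
          rw [hn, mul_inv_cancel_left]
      · rintro _ ⟨v, rfl⟩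
        rw [Subgroup.mem_center_iff]
        intro x
        obtain ⟨g, rfl⟩ := QuotientGroup.mk_surjective x
        exact congrArg (QuotientGroup.mk' Z) (Subgroup.mem_center_iff.1 (hcen ⟨c v, rfl⟩) g)
    refine hG1.of_ker_eq_zpowers (QuotientGroup.mk' Z) (QuotientGroup.mk'_surjective Z) (ι e) hec
      ?_ (QuotientGroup.ker_mk' Z)
    rw [← injective_zpow_iff_not_isOfFinOrder]
    intro a b hab
    simp only [← map_zpow] at hab
    have := congrArg Multiplicative.toAdd (hι hab)
    rw [hez, hez] at this
    simpa using congrFun this 0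

end RegularExt

/-! ### Linear algebra of the Steinberg relations in small dimension. -/

section SteinbergSystem

open Module

/-- Elements `x i j` of a monoid, for distinct `i, j` in a finite set `S`, which satisfy the
Steinberg commutator relations. -/
structure IsSteinbergSystem {ι M : Type*} [Monoid M] (S : Finset ι) (x : ι → ι → M) : Prop where
  commute : ∀ i ∈ S, ∀ j ∈ S, ∀ p ∈ S, ∀ q ∈ S, i ≠ j → p ≠ q → j ≠ p → i ≠ q →
    x i j * x p q = x p q * x i j
  comm_mul : ∀ i ∈ S, ∀ j ∈ S, ∀ l ∈ S, i ≠ j → j ≠ l → i ≠ l →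
    x i j * x j l = x i l * x j l * x i j

variable {ι : Type*} {K : Type*} [Field K]

section Eigenvectors

variable {V : Type*} [AddCommGroup V] [Module K V] [FiniteDimensional K V]

lemma exists_common_eigenvector [DecidableEq ι] [IsAlgClosed K] (T : Finset ι) (y : ι → End K V)
    (hy : ∀ i ∈ T, ∀ j ∈ T, y i * y j = y j * y i) (E : Submodule K V) (hE : E ≠ ⊥)
    (hinv : ∀ i ∈ T, ∀ v ∈ E, y i v ∈ E) :
    ∃ v ∈ E, v ≠ 0 ∧ ∀ j ∈ T, ∃ c : K, y j v = c • v := by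
  induction T using Finset.induction_on generalizing E with
  | empty =>
    obtain ⟨v, hv, hv0⟩ := E.ne_bot_iff.1 hE
    exact ⟨v, hv, hv0, by simp⟩
  | insert a T ha ih =>
    have hnt : Nontrivial E := Submodule.nontrivial_iff_ne_bot.2 hE
    have hia := hinv a (Finset.mem_insert_self a T)
    obtain ⟨c, hc⟩ := Module.End.exists_eigenvalue ((y a).restrict hia)
    obtain ⟨w, hw⟩ := hc.exists_hasEigenvector
    have hw1 : y a (w : V) = c • (w : V) := congrArg Subtype.val hw.apply_eq_smul
    have hw0 : (w : V) ≠ 0 := fun h => hw.2 (Subtype.ext h)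
    obtain ⟨v, hv, hv0, hvT⟩ := ih (fun i hi j hj => hy i (Finset.mem_insert_of_mem hi) j
      (Finset.mem_insert_of_mem hj)) (E ⊓ End.eigenspace (y a) c)
      (fun h => hw0 ((Submodule.mem_bot K).1 (h ▸ ⟨w.2, End.mem_eigenspace_iff.2 hw1⟩)))
      (fun i hi v hv => ⟨hinv i (Finset.mem_insert_of_mem hi) v hv.1, by
        have h1 := End.mem_eigenspace_iff.1 hv.2
        change y i v ∈ End.eigenspace (y a) c
        rw [End.mem_eigenspace_iff, ← Module.End.mul_apply,
          hy a (Finset.mem_insert_self a T) i (Finset.mem_insert_of_mem hi),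
          Module.End.mul_apply, h1, map_smul]⟩)
    refine ⟨v, hv.1, hv0, fun j hj => ?_⟩
    rcases Finset.mem_insert.1 hj with rfl | hj
    · exact ⟨c, End.mem_eigenspace_iff.1 hv.2⟩
    · exact hvT j hj

/-- Simultaneous eigenvectors with distinct weights are linearly independent. Different pairs may be
separated by different operators: to isolate the coefficient at `i`, an operator separating `i` from
`a` is used to remove the term at `a`. -/
lemma card_le_finrank_of_distinct_weights {σ : Type*} [Fintype σ] (T : Finset ι)
    (y : ι → End K V) (w : σ → ι → K) (v : σ → V) (hv : ∀ s, v s ≠ 0)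
    (h : ∀ s, ∀ j ∈ T, y j (v s) = w s j • v s)
    (hw : ∀ s t, s ≠ t → ∃ j ∈ T, w s j ≠ w t j) : Fintype.card σ ≤ finrank K V := by
  classical
  refine LinearIndependent.fintype_card_le_finrank (b := v) ?_
  rw [linearIndependent_iff']
  intro s
  induction s using Finset.induction_on with
  | empty => simp
  | insert a s ha ih =>
    intro g hg
    have key : ∀ i ∈ s, g i = 0 := by
      intro i hi
      obtain ⟨j, hj, hne⟩ := hw i a (fun h => ha (h ▸ hi))
      have h1 : ∑ t ∈ insert a s, (g t * (w t j - w a j)) • v t = 0 := by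
        have h2 := congrArg (fun z => y j z - w a j • z) hg
        simp only [map_sum, map_smul, Finset.smul_sum, smul_zero, map_zero, sub_zero,
          ← Finset.sum_sub_distrib] at h2
        rw [← h2]
        refine Finset.sum_congr rfl fun t _ => ?_
        rw [h t j hj, smul_smul, smul_smul, ← sub_smul]
        congr 1
        ring
      rw [Finset.sum_insert ha, sub_self, mul_zero, zero_smul, zero_add] at h1
      have h3 := ih _ h1 i hi
      exact (mul_eq_zero.1 h3).resolve_right (sub_ne_zero.2 hne)
    intro i hi
    rcases Finset.mem_insert.1 hi with rfl | hi
    · rw [Finset.sum_insert ha, Finset.sum_eq_zero (fun t ht => by rw [key t ht, zero_smul]),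
        add_zero, smul_eq_zero] at hg
      exact hg.resolve_right (hv _)
    · exact key i hi

lemma isNilpotent_sub_one_of_eigenvalues [IsAlgClosed K] (f : End K V)
    (h : ∀ c, f.HasEigenvalue c → c = 1) : IsNilpotent (f - 1) := by
  have h1 : ⨆ c, f.maxGenEigenspace c = f.maxGenEigenspace 1 := by
    refine le_antisymm (iSup_le fun c => ?_) (le_iSup f.maxGenEigenspace 1)
    by_cases hc : f.HasEigenvalue c
    · rw [h c hc]
    · have : f.maxGenEigenspace c = ⊥ := by
        by_contra h'
        exact hc (End.HasUnifEigenvalue.lt zero_lt_one h')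
      rw [this]
      exact bot_le
  rw [End.iSup_maxGenEigenspace_eq_top] at h1
  refine ⟨finrank K V, LinearMap.ext fun v => ?_⟩
  have : v ∈ f.maxGenEigenspace 1 := h1 ▸ Submodule.mem_top
  rw [End.maxGenEigenspace_eq_genEigenspace_finrank, End.mem_genEigenspace_nat] at this
  simpa using this

end Eigenvectors

/-- In dimension less than `|S|`, the members of a Steinberg system are unipotent. -/
lemma IsSteinbergSystem.isNilpotent_sub_one [DecidableEq ι] [IsAlgClosed K] {V : Type*} [AddCommGroup V]
    [Module K V] [FiniteDimensional K V] {S : Finset ι} {x : ι → ι → End K V}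
    (hx : IsSteinbergSystem S x) (hinj : ∀ i j, Function.Injective (x i j)) (hS : 3 ≤ S.card)
    (hV : finrank K V < S.card) {a b : ι} (ha : a ∈ S) (hb : b ∈ S) (hab : a ≠ b) :
    IsNilpotent (x a b - 1) := by
  refine isNilpotent_sub_one_of_eigenvalues _ fun c hc => ?_
  by_contra hc1
  let T := S.erase a
  have hTS (j) (hj : j ∈ T) : j ∈ S ∧ a ≠ j := ⟨Finset.mem_of_mem_erase hj,
    (Finset.ne_of_mem_erase hj).symm⟩
  have hbT : b ∈ T := Finset.mem_erase.2 ⟨hab.symm, hb⟩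
  -- The operators `x a j` of row `a` commute, so they have simultaneous eigenvectors; `χ` records
  -- the eigenvalues.
  let IsWeight (χ : ι → K) : Prop := ∃ v : V, v ≠ 0 ∧ ∀ j ∈ T, x a j v = χ j • v
  have hcomm (i) (hi : i ∈ T) (j) (hj : j ∈ T) : x a i * x a j = x a j * x a i :=
    hx.commute a ha i (hTS i hi).1 a ha j (hTS j hj).1 (hTS i hi).2 (hTS j hj).2
      (hTS i hi).2.symm (hTS j hj).2
  have hne (χ) (hχ : IsWeight χ) (j) (hj : j ∈ T) : χ j ≠ 0 := by
    obtain ⟨v, hv, h⟩ := hχ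
    intro h0
    have := h j hj
    rw [h0, zero_smul] at this
    exact hv (hinj a j (this.trans (map_zero _).symm))
  -- Applying `x i j` to a weight vector acts on weights as an elementary operation: the relation `x
  -- a i * x i j = x a j * x i j * x a i` multiplies the value at `i` by the value at `j`.
  have hmove (χ) (hχ : IsWeight χ) (i) (hi : i ∈ T) (j) (hj : j ∈ T) (hij : i ≠ j) :
      IsWeight (Function.update χ i (χ i * χ j)) := by
    obtain ⟨v, hv, h⟩ := hχ
    obtain ⟨hiS, hai⟩ := hTS i hi
    obtain ⟨hjS, haj⟩ := hTS j hj
    refine ⟨x i j v, fun h0 => hv (hinj i j (h0.trans (map_zero _).symm)), fun l hl => ?_⟩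
    obtain ⟨hlS, hal⟩ := hTS l hl
    by_cases hli : l = i
    · subst hli
      rw [Function.update_self, ← Module.End.mul_apply, hx.comm_mul a ha l hiS j hjS hai hij haj,
        Module.End.mul_apply, Module.End.mul_apply, h l hl, map_smul, map_smul,
        ← Module.End.mul_apply, hx.commute a ha j hjS l hiS j hjS haj hij hij.symm haj,
        Module.End.mul_apply, h j hj, map_smul, smul_smul]
    · rw [Function.update_of_ne hli, ← Module.End.mul_apply,
        hx.commute a ha l hlS i hiS j hjS hal hij hli haj, Module.End.mul_apply, h l hl, map_smul]
  obtain ⟨χ, hχ, hχb⟩ : ∃ χ, IsWeight χ ∧ χ b = c := by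
    obtain ⟨v, hv, hv0, h⟩ := exists_common_eigenvector T (x a) hcomm (End.eigenspace (x a b) c)
      hc (fun i hi v hv => by
        rw [End.mem_eigenspace_iff] at hv ⊢
        rw [← Module.End.mul_apply, hcomm b hbT i hi, Module.End.mul_apply, hv, map_smul])
    choose! χ hχ using h
    refine ⟨χ, ⟨v, hv0, hχ⟩, ?_⟩
    have h1 := hχ b hbT
    rw [End.mem_eigenspace_iff.1 hv] at h1
    exact (smul_left_injective K hv0 h1).symm
  obtain ⟨d, hd⟩ : ∃ d, d ∈ T.erase b := by
    rw [← Finset.Nonempty, ← Finset.card_pos, Finset.card_erase_of_mem hbT,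
      Finset.card_erase_of_mem ha]
    omega
  obtain ⟨hdb, hdT⟩ := Finset.mem_erase.1 hd
  -- a weight whose value at `b` differs from `c`
  obtain ⟨ψ, hψ, hψb⟩ : ∃ ψ, IsWeight ψ ∧ ψ b ≠ c := by
    -- Moving at `b` along `d` changes the value at `b` only if the value at `d` is not `1`; when it
    -- is `1`, a first move at `d` along `b` turns it into `c`.
    obtain ⟨φ, hφ, hφb, hφd⟩ : ∃ φ, IsWeight φ ∧ φ b = c ∧ φ d ≠ 1 := by
      by_cases h1 : χ d = 1
      · refine ⟨_, hmove χ hχ d hdT b hbT hdb, ?_, ?_⟩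
        · rw [Function.update_of_ne hdb.symm, hχb]
        · rw [Function.update_self, h1, hχb, one_mul]
          exact hc1
      · exact ⟨χ, hχ, hχb, h1⟩
    refine ⟨_, hmove φ hφ b hbT d hdT hdb.symm, ?_⟩
    rw [Function.update_self]
    intro h
    have := hne φ hφ b hbT
    rw [← hφb] at h
    exact hφd (mul_left_cancel₀ this (h.trans (mul_one _).symm))
  -- One weight for each element of `S`: the slot `a` holds `ψ`, the only one whose value at `b` is
  -- not `c`; `b` holds `χ`; any other `s` holds `χ` altered at `s` alone by the factor `c ≠ 1`.
  -- These `S.card` distinct weights exceed the dimension.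
  let w : S → ι → K := fun s => if s.1 = a then ψ else if s.1 = b then χ else
    Function.update χ s.1 (χ s.1 * χ b)
  have hw (s : S) : IsWeight (w s) := by
    simp only [w]
    split_ifs with h1 h2
    · exact hψ
    · exact hχ
    · exact hmove χ hχ s.1 (Finset.mem_erase.2 ⟨h1, s.2⟩) b hbT h2
  have hwb (s : S) (h1 : s.1 ≠ a) : w s b = c := by
    simp only [w, if_neg h1]
    split_ifs with h2
    · exact hχb
    · rw [Function.update_of_ne (Ne.symm h2), hχb]
  have hws (s : S) (h1 : s.1 ≠ a) (h2 : s.1 ≠ b) : w s s.1 ≠ χ s.1 := by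
    simp only [w, if_neg h1, if_neg h2, Function.update_self, hχb]
    intro h
    exact hc1 (mul_left_cancel₀ (hne χ hχ s.1 (Finset.mem_erase.2 ⟨h1, s.2⟩))
      (h.trans (mul_one _).symm))
  have hwt (s t : S) (h1 : t.1 ≠ a) (h2 : s ≠ t) : w t s.1 = χ s.1 := by
    simp only [w, if_neg h1]
    split_ifs with h3
    · rfl
    · rw [Function.update_of_ne (fun h => h2 (Subtype.ext h))]
  choose v hv0 hv using hw
  have := card_le_finrank_of_distinct_weights T (x a) w v hv0 hv (by
    have hψw (s : S) (h : s.1 = a) : w s = ψ := by simp [w, h]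
    intro s t hst
    by_cases hs : s.1 = a
    · have ht : t.1 ≠ a := fun h => hst (Subtype.ext (hs.trans h.symm))
      exact ⟨b, hbT, by rw [hψw s hs, hwb t ht]; exact hψb⟩
    by_cases ht : t.1 = a
    · exact ⟨b, hbT, by rw [hψw t ht, hwb s hs]; exact hψb.symm⟩
    by_cases hsb : s.1 = b
    · have htb : t.1 ≠ b := fun h => hst (Subtype.ext (hsb.trans h.symm))
      exact ⟨t.1, Finset.mem_erase.2 ⟨ht, t.2⟩, by
        rw [hwt t s hs hst.symm]; exact (hws t ht htb).symm⟩
    · exact ⟨s.1, Finset.mem_erase.2 ⟨hs, s.2⟩, by rw [hwt s t ht hst]; exact hws s hs hsb⟩)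
  rw [Fintype.card_coe] at this
  omega

open Classical in
/-- The restriction of an endomorphism to a submodule which it preserves, and `1` otherwise. -/
noncomputable def restrictOrOne {V : Type*} [AddCommGroup V] [Module K V] (W : Submodule K V)
    (f : End K V) : End K W :=
  if h : ∀ v ∈ W, f v ∈ W then f.restrict h else 1

open Classical in
/-- The endomorphism induced on the quotient by a submodule which is preserved, and `1`
otherwise. -/
noncomputable def quotientOrOne {V : Type*} [AddCommGroup V] [Module K V] (W : Submodule K V)
    (f : End K V) : End K (V ⧸ W) :=
  if h : ∀ v ∈ W, f v ∈ W then W.mapQ W f h else 1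

/-- Serves to pass to an invariant subspace or its quotient, where the relations survive for the
smaller index set preserving the subspace. -/
lemma IsSteinbergSystem.of_apply {U V : Type*} [AddCommGroup V] [Module K V] [AddCommGroup U]
    [Module K U] {S T : Finset ι} (hTS : T ⊆ S) {x : ι → ι → End K V} {y : ι → ι → End K U}
    (hx : IsSteinbergSystem S x)
    (h : ∀ i ∈ T, ∀ j ∈ T, ∀ p ∈ T, ∀ q ∈ T, i ≠ j → p ≠ q →
      x i j * x p q = x p q * x i j → y i j * y p q = y p q * y i j)
    (h' : ∀ i ∈ T, ∀ j ∈ T, ∀ l ∈ T, i ≠ j → j ≠ l → i ≠ l →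
      x i j * x j l = x i l * x j l * x i j → y i j * y j l = y i l * y j l * y i j) :
    IsSteinbergSystem T y where
  commute i hi j hj p hp q hq hij hpq hjp hiq := h i hi j hj p hp q hq hij hpq
    (hx.commute i (hTS hi) j (hTS hj) p (hTS hp) q (hTS hq) hij hpq hjp hiq)
  comm_mul i hi j hj l hl hij hjl hil := h' i hi j hj l hl hij hjl hil
    (hx.comm_mul i (hTS hi) j (hTS hj) l (hTS hl) hij hjl hil)

/-- A Steinberg system of unipotent endomorphisms in dimension less than `|S|` is trivial. -/
theorem IsSteinbergSystem.eq_one_of_isNilpotent [DecidableEq ι] [IsAlgClosed K] {S : Finset ι} :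
    ∀ {V : Type v} [AddCommGroup V] [Module K V] [FiniteDimensional K V] {x : ι → ι → End K V},
    IsSteinbergSystem S x → (∀ i ∈ S, ∀ j ∈ S, i ≠ j → IsNilpotent (x i j - 1)) →
    finrank K V < S.card → ∀ i ∈ S, ∀ j ∈ S, i ≠ j → x i j = 1 := by
  induction S using Finset.strongInduction with
  | H S ih =>
  intro V _ _ _ x hx hnil hV a ha b hb hab
  set T := S.erase a with hT
  have hTS (j) (hj : j ∈ T) : j ∈ S ∧ a ≠ j := ⟨Finset.mem_of_mem_erase hj,
    (Finset.ne_of_mem_erase hj).symm⟩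
  have hbT : b ∈ T := Finset.mem_erase.2 ⟨hab.symm, hb⟩
  -- The common fixed space of row `a`. It is nonzero, since commuting unipotents share an
  -- eigenvector, and stable under the `x i j` with `i, j ∈ T`. If it is proper, then `W` and `V ⧸
  -- W` both have dimension below `T.card`, and induction makes the `T`-system trivial on both.
  let W : Submodule K V := ⨅ j ∈ T, LinearMap.ker (x a j - 1)
  have hW (v : V) : v ∈ W ↔ ∀ j ∈ T, x a j v = v := by
    simp [W, Submodule.mem_iInf, sub_eq_zero]
  suffices hWtop : W = ⊤ by
    refine LinearMap.ext fun v => ?_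
    exact (hW v).1 (hWtop ▸ Submodule.mem_top) b hbT
  by_contra hWne
  have hcomm (i) (hi : i ∈ T) (j) (hj : j ∈ T) : x a i * x a j = x a j * x a i :=
    hx.commute a ha i (hTS i hi).1 a ha j (hTS j hj).1 (hTS i hi).2 (hTS j hj).2
      (hTS i hi).2.symm (hTS j hj).2
  have hVnt : Nontrivial V := by
    by_contra h
    rw [not_nontrivial_iff_subsingleton] at h
    exact hWne (Subsingleton.elim _ _)
  have hWbot : W ≠ ⊥ := by
    obtain ⟨v, -, hv0, hv⟩ := exists_common_eigenvector T (x a) hcomm ⊤ top_ne_bot (by simp)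
    refine (Submodule.ne_bot_iff _).2 ⟨v, (hW v).2 fun j hj => ?_, hv0⟩
    obtain ⟨c, hc⟩ := hv j hj
    obtain ⟨m, hm⟩ := hnil a ha j (hTS j hj).1 (hTS j hj).2
    have hpow (m : ℕ) : ((x a j - 1) ^ m) v = (c - 1) ^ m • v := by
      induction m with
      | zero => simp
      | succ m ih =>
        rw [pow_succ', Module.End.mul_apply, ih, map_smul, LinearMap.sub_apply, hc,
          Module.End.one_apply, pow_succ, mul_smul, sub_smul, one_smul]
    have h1 := hpow m
    rw [hm, LinearMap.zero_apply, eq_comm, smul_eq_zero, or_iff_left hv0] at h1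
    rw [hc, sub_eq_zero.1 (eq_zero_of_pow_eq_zero h1), one_smul]
  have hinv (i) (hi : i ∈ T) (j) (hj : j ∈ T) (hij : i ≠ j) : ∀ v ∈ W, x i j v ∈ W := by
    intro v hv
    rw [hW] at hv ⊢
    intro l hl
    obtain ⟨hiS, hai⟩ := hTS i hi
    obtain ⟨hjS, haj⟩ := hTS j hj
    obtain ⟨hlS, hal⟩ := hTS l hl
    by_cases hli : l = i
    · subst hli
      rw [← Module.End.mul_apply, hx.comm_mul a ha l hiS j hjS hai hij haj,
        Module.End.mul_apply, Module.End.mul_apply, hv l hl,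
        ← Module.End.mul_apply, hx.commute a ha j hjS l hiS j hjS haj hij hij.symm haj,
        Module.End.mul_apply, hv j hj]
    · rw [← Module.End.mul_apply, hx.commute a ha l hlS i hiS j hjS hal hij hli haj,
        Module.End.mul_apply, hv l hl]
  have hdim1 : finrank K W < T.card := by
    have := Submodule.finrank_lt hWne
    rw [hT, Finset.card_erase_of_mem ha]
    omega
  have hdim2 : finrank K (V ⧸ W) < T.card := by
    have h1 := Submodule.finrank_quotient_add_finrank W
    have h2 : 0 < finrank K W := Submodule.one_le_finrank_iff.2 hWbot
    rw [hT, Finset.card_erase_of_mem ha]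
    omega
  have hsub : T ⊂ S := Finset.erase_ssubset ha
  have hrW (i) (hi : i ∈ T) (j) (hj : j ∈ T) (hij : i ≠ j) (v : V) (hv : v ∈ W) :
      x i j v = v := by
    have hr (i) (hi : i ∈ T) (j) (hj : j ∈ T) (hij : i ≠ j) (v : W) :
        (restrictOrOne W (x i j) v : V) = x i j v := by
      rw [restrictOrOne, dif_pos (hinv i hi j hj hij)]
      rfl
    have hsys : IsSteinbergSystem T fun i j => restrictOrOne W (x i j) := by
      refine IsSteinbergSystem.of_apply hsub.1 hx ?_ ?_
      · intro i hi j hj p hp q hq hij hpq h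
        refine LinearMap.ext fun v => Subtype.ext ?_
        rw [Module.End.mul_apply, Module.End.mul_apply, hr i hi j hj hij, hr p hp q hq hpq,
          hr p hp q hq hpq, hr i hi j hj hij]
        exact LinearMap.congr_fun h v.1
      · intro i hi j hj l hl hij hjl hil h
        refine LinearMap.ext fun v => Subtype.ext ?_
        simp only [Module.End.mul_apply]
        rw [hr i hi j hj hij, hr j hj l hl hjl, hr i hi l hl hil, hr j hj l hl hjl,
          hr i hi j hj hij]
        exact LinearMap.congr_fun h v.1
    have := ih T hsub hsys (fun i hi j hj hij => by
      obtain ⟨m, hm⟩ := hnil i (hTS i hi).1 j (hTS j hj).1 hij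
      refine ⟨m, LinearMap.ext fun v => Subtype.ext ?_⟩
      have hpow (m : ℕ) (v : W) : (((restrictOrOne W (x i j) - 1) ^ m) v : V) =
          ((x i j - 1) ^ m) v := by
        induction m generalizing v with
        | zero => rfl
        | succ m ih =>
          rw [pow_succ, Module.End.mul_apply, ih, pow_succ, Module.End.mul_apply]
          congr 1
          simp [hr i hi j hj hij]
      rw [hpow, hm]
      rfl) hdim1 i hi j hj hij
    have h1 := hr i hi j hj hij ⟨v, hv⟩
    rw [this] at h1
    exact h1.symm
  have hrQ (i) (hi : i ∈ T) (j) (hj : j ∈ T) (hij : i ≠ j) (v : V) : x i j v - v ∈ W := by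
    have hr (i) (hi : i ∈ T) (j) (hj : j ∈ T) (hij : i ≠ j) (v : V) :
        quotientOrOne W (x i j) (W.mkQ v) = W.mkQ (x i j v) := by
      rw [quotientOrOne, dif_pos (hinv i hi j hj hij)]
      rfl
    have hsys : IsSteinbergSystem T fun i j => quotientOrOne W (x i j) := by
      refine IsSteinbergSystem.of_apply hsub.1 hx ?_ ?_
      · intro i hi j hj p hp q hq hij hpq h
        refine Submodule.linearMap_qext W (LinearMap.ext fun v => ?_)
        simp only [LinearMap.comp_apply, Module.End.mul_apply]
        rw [hr i hi j hj hij, hr p hp q hq hpq, hr i hi j hj hij, hr p hp q hq hpq]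
        exact congrArg W.mkQ (LinearMap.congr_fun h v)
      · intro i hi j hj l hl hij hjl hil h
        refine Submodule.linearMap_qext W (LinearMap.ext fun v => ?_)
        simp only [LinearMap.comp_apply, Module.End.mul_apply]
        rw [hr i hi j hj hij, hr j hj l hl hjl, hr j hj l hl hjl, hr i hi l hl hil,
          hr i hi j hj hij]
        exact congrArg W.mkQ (LinearMap.congr_fun h v)
    have := ih T hsub hsys (fun i hi j hj hij => by
      obtain ⟨m, hm⟩ := hnil i (hTS i hi).1 j (hTS j hj).1 hij
      refine ⟨m, Submodule.linearMap_qext W (LinearMap.ext fun v => ?_)⟩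
      have hpow (m : ℕ) (v : V) : ((quotientOrOne W (x i j) - 1) ^ m) (W.mkQ v) =
          W.mkQ (((x i j - 1) ^ m) v) := by
        induction m generalizing v with
        | zero => rfl
        | succ m ih =>
          rw [pow_succ, Module.End.mul_apply, pow_succ, Module.End.mul_apply, ← ih]
          congr 1
          simp only [LinearMap.sub_apply, Module.End.one_apply, hr i hi j hj hij, map_sub]
      rw [LinearMap.comp_apply, hpow, hm]
      simp) hdim2 i hi j hj hij
    have h1 := hr i hi j hj hij v
    rw [this, Module.End.one_apply] at h1
    rw [← Submodule.Quotient.eq]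
    exact h1.symm
  have hex (j) : ∃ i ∈ T, i ≠ j := by
    by_contra! h
    have : T.card ≤ 1 := Finset.card_le_one.2 fun p hp q hq => (h p hp).trans (h q hq).symm
    have h2 : 0 < finrank K W := Submodule.one_le_finrank_iff.2 hWbot
    omega
  have hunit (i) (hi : i ∈ T) : Function.Surjective (x a i) := by
    have h1 := (hnil a ha i (hTS i hi).1 (hTS i hi).2).isUnit_one_add
    rw [add_sub_cancel] at h1
    exact ((Module.End.isUnit_iff _).1 h1).2
  -- The commutator relation evaluated at `v`, using that row `a` fixes the differences `x i j u -
  -- u`, which lie in `W`.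
  have hrel (i) (hi : i ∈ T) (j) (hj : j ∈ T) (hij : i ≠ j) (v : V) :
      x a j (x a i v) - x a i v = (x i j v - v) - (x i j (x a i v) - x a i v) := by
    obtain ⟨hiS, hai⟩ := hTS i hi
    obtain ⟨hjS, haj⟩ := hTS j hj
    have h1 := LinearMap.congr_fun (hx.comm_mul a ha i hiS j hjS hai hij haj) v
    simp only [Module.End.mul_apply] at h1
    have h2 : x a i (x i j v - v) = x i j v - v := (hW _).1 (hrQ i hi j hj hij v) i hi
    have h3 := (hW _).1 (hrQ i hi j hj hij (x a i v)) j hj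
    rw [map_sub, h1] at h2
    rw [map_sub, sub_eq_iff_eq_add] at h3
    rw [h3] at h2
    rw [← h2]
    abel
  have hmem (j) (hj : j ∈ T) (v : V) : x a j v - v ∈ W := by
    obtain ⟨i, hi, hij⟩ := hex j
    obtain ⟨v, rfl⟩ := hunit i hi v
    rw [hrel i hi j hj hij]
    exact sub_mem (hrQ i hi j hj hij _) (hrQ i hi j hj hij _)
  -- By `hmem`, `x a i v - v` lies in `W` and is fixed by `x i j`, so the two differences on the
  -- right of `hrel` cancel. Hence `x a j` fixes the image of `x a i`, which is everything.
  refine hWne (eq_top_iff.2 fun v _ => (hW v).2 fun j hj => ?_)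
  obtain ⟨i, hi, hij⟩ := hex j
  obtain ⟨v, rfl⟩ := hunit i hi v
  have h1 := hrW i hi j hj hij _ (hmem i hi v)
  have h2 := hrel i hi j hj hij v
  rw [map_sub] at h1
  rw [← sub_eq_zero, h2, sub_sub_sub_comm, ← neg_sub (x i j (x a i v)), h1, neg_sub, sub_self]

end SteinbergSystem

/-! ### Homomorphisms out of the Steinberg group. -/

section SteinbergGroupHom

open Module

/-- The generator `x_{ij}(r)` of the Steinberg group. -/
def SteinbergGroup.x {n : ℕ} {R : Type v} [Ring R] (i j : Fin n) (hij : i ≠ j) (r : R) :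
    SteinbergGroup n R :=
  PresentedGroup.of (⟨(i, j), hij⟩, r)

namespace SteinbergGroup

variable {n : ℕ} {R : Type v} [Ring R]

lemma x_mul_x_of_ne {i j p q : Fin n} (hij : i ≠ j) (hpq : p ≠ q) (hjp : j ≠ p) (hiq : i ≠ q)
    (r s : R) : x i j hij r * x p q hpq s = x p q hpq s * x i j hij r := by
  have : (PresentedGroup.mk {w | SteinbergRel n R w}) _ = 1 :=
    PresentedGroup.one_of_mem (SteinbergRel.comm_one i j p q hij hpq hjp hiq r s)
  simp only [map_mul, map_inv] at this
  exact mul_inv_eq_iff_eq_mul.1 (mul_inv_eq_one.1 this)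

lemma x_mul_x {i j l : Fin n} (hij : i ≠ j) (hjl : j ≠ l) (hil : i ≠ l)
    (r s : R) : x i j hij r * x j l hjl s = x i l hil (r * s) * x j l hjl s * x i j hij r := by
  have : (PresentedGroup.mk {w | SteinbergRel n R w}) _ = 1 :=
    PresentedGroup.one_of_mem (SteinbergRel.comm_mul i j l hij hjl hil r s)
  simp only [map_mul, map_inv] at this
  exact mul_inv_eq_iff_eq_mul.1 (mul_inv_eq_iff_eq_mul.1 (mul_inv_eq_one.1 this))

lemma exists_ne_ne (hn : 3 ≤ n) (i j : Fin n) : ∃ l, i ≠ l ∧ l ≠ j := by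
  by_contra! h
  have h1 : (Finset.univ : Finset (Fin n)) ⊆ {i, j} := fun l _ => by
    by_cases hl : i = l
    · simp [hl]
    · simp [h l hl]
  have := (Finset.card_le_card h1).trans Finset.card_le_two
  rw [Finset.card_univ, Fintype.card_fin] at this
  omega

/-- With a third index `l`, `x_{ij}(r)` is the commutator of `x_{il}(r)` and `x_{lj}(1)`. -/
lemma hom_eq_one_of_x_one (hn : 3 ≤ n) {H : Type*} [Group H] (f : SteinbergGroup n R →* H)
    (hf : ∀ i j hij, f (x i j hij 1) = 1) : f = 1 := by
  refine PresentedGroup.ext fun ⟨⟨⟨i, j⟩, hij⟩, r⟩ => ?_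
  obtain ⟨l, hil, hlj⟩ := exists_ne_ne hn i j
  have h := congrArg f (x_mul_x hil hlj hij r 1)
  simp only [map_mul, hf, mul_one] at h
  exact right_eq_mul.1 h |>.trans rfl

/-- Perfectness of the Steinberg group: every generator is a commutator. -/
lemma hom_eq_one_of_commute (hn : 3 ≤ n) {H : Type*} [Group H] (f : SteinbergGroup n R →* H)
    (hf : ∀ a b, f a * f b = f b * f a) : f = 1 := by
  refine PresentedGroup.ext fun ⟨⟨⟨i, j⟩, hij⟩, r⟩ => ?_
  obtain ⟨l, hil, hlj⟩ := exists_ne_ne hn i j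
  have h := congrArg f (x_mul_x hil hlj hij r 1)
  simp only [map_mul, mul_one, mul_assoc] at h
  rw [hf (x i l hil r)] at h
  exact right_eq_mul.1 h |>.trans rfl

/-- Representations of `St_n(ℤ)` of dimension less than `n` are trivial. -/
theorem hom_end_eq_one (hn : 3 ≤ n) {K : Type*} [Field K] [IsAlgClosed K] {V : Type v}
    [AddCommGroup V] [Module K V] [FiniteDimensional K V] (hV : finrank K V < n)
    {H : Type*} [Group H] (f : SteinbergGroup n R →* H) (ρ : H →* End K V)
    (hρ : Function.Injective ρ) : f = 1 := by
  classical
  refine hom_eq_one_of_x_one hn f fun i j hij => ?_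
  let y : Fin n → Fin n → End K V := fun i j =>
    if h : i ≠ j then ρ (f (x i j h 1)) else 1
  have hy (i j) (h : i ≠ j) : y i j = ρ (f (x i j h 1)) := dif_pos h
  have hsys : IsSteinbergSystem Finset.univ y := by
    constructor
    · intro i _ j _ p _ q _ hij hpq hjp hiq
      rw [hy i j hij, hy p q hpq, ← map_mul, ← map_mul, x_mul_x_of_ne hij hpq hjp hiq, map_mul,
        map_mul]
    · intro i _ j _ l _ hij hjl hil
      have h := x_mul_x hij hjl hil (1 : R) 1
      rw [mul_one] at h
      rw [hy i j hij, hy j l hjl, hy i l hil, ← map_mul, ← map_mul, h, map_mul, map_mul, map_mul,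
        map_mul]
  have hcard : (Finset.univ : Finset (Fin n)).card = n := by simp
  have hunit (h : H) : Function.Injective (ρ h) :=
    ((Module.End.isUnit_iff _).1 ((Group.isUnit h).map ρ)).1
  have hinj (i j) : Function.Injective (y i j) := by
    by_cases h : i ≠ j
    · rw [hy i j h]
      exact hunit _
    · simp only [y, dif_neg h]
      exact Function.injective_id
  have := hsys.eq_one_of_isNilpotent (fun i hi j hj hij =>
    hsys.isNilpotent_sub_one hinj (by omega) (by omega) hi hj hij) (by omega) i (Finset.mem_univ i)
    j (Finset.mem_univ j) hij
  rw [hy i j hij] at this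
  exact hρ (this.trans (map_one ρ).symm)

end SteinbergGroup

/-- Automorphisms of `ℤ^r` as endomorphisms of a `ℤ`-module. -/
def latticeAutToEnd (r : ℕ) :
    MulAut (Multiplicative (Fin r → ℤ)) →* Module.End ℤ (Fin r → ℤ) where
  toFun φ := AddMonoidHom.toIntLinearMap
    { toFun := fun v => (φ (Multiplicative.ofAdd v)).toAdd
      map_zero' := by simp
      map_add' := by simp }
  map_one' := rfl
  map_mul' _ _ := rfl

lemma latticeAutToEnd_injective (r : ℕ) : Function.Injective (latticeAutToEnd r) :=
  fun _ _ h => MulEquiv.ext fun v => Multiplicative.toAdd.injective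
    (LinearMap.congr_fun h v.toAdd)

/-- Integer matrices embed in complex ones, so the automorphisms of `ℤ^r` act faithfully on `ℂ^r`,
where eigenvalues are available. -/
theorem SteinbergGroup.hom_mulAut_eq_one {n : ℕ} (hn : 3 ≤ n) {r : ℕ} (hr : r < n) {A : Type*}
    [Group A] (e : A ≃* Multiplicative (Fin r → ℤ)) (f : SteinbergGroup n ℤ →* MulAut A) :
    f = 1 := by
  refine hom_end_eq_one (K := ℂ) (V := Fin r → ℂ) hn (by simpa using hr) f
    ((((Matrix.toLinAlgEquiv' (R := ℂ) (n := Fin r)).toRingEquiv.toMonoidHom.comp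
      (Int.castRingHom ℂ).mapMatrix.toMonoidHom).comp
      (LinearMap.toMatrixAlgEquiv' (R := ℤ) (n := Fin r)).toRingEquiv.toMonoidHom).comp
      ((latticeAutToEnd r).comp (MulAut.congr e).toMonoidHom)) ?_
  refine (((Matrix.toLinAlgEquiv' (R := ℂ) (n := Fin r)).injective.comp ?_).comp
    (LinearMap.toMatrixAlgEquiv' (R := ℤ) (n := Fin r)).injective).comp
    ((latticeAutToEnd_injective r).comp (MulAut.congr e).injective)
  exact Matrix.map_injective Int.cast_injective

end SteinbergGroupHom

/-! ### Finitely generated torsion-free nilpotent groups and their centres. -/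

section NilpotentGroup

open Subgroup
open scoped commutatorElement

variable {G : Type*} [Group G]

lemma pow_commutator_of_mem_center {x g : G} (h : ⁅x, g⁆ ∈ center G) (m : ℕ) :
    ⁅x ^ m, g⁆ = ⁅x, g⁆ ^ m := by
  induction m with
  | zero => simp
  | succ m ih =>
    have h1 := mem_center_iff.1 h (x ^ m)
    rw [pow_succ ⁅x, g⁆, ← ih]
    calc ⁅x ^ (m + 1), g⁆ = (x ^ m * ⁅x, g⁆) * g * (x ^ m)⁻¹ * g⁻¹ := by
          simp only [commutatorElement_def, pow_succ]; group
      _ = ⁅x, g⁆ * ⁅x ^ m, g⁆ := by rw [h1, commutatorElement_def (x ^ m)]; group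
      _ = _ := (mem_center_iff.1 h _).symm

/-- The quotients of the upper central series of a torsion-free group are torsion-free. -/
lemma mem_upperCentralSeries_of_pow_mem (hG : ∀ g : G, g ≠ 1 → ¬ IsOfFinOrder g) {m : ℕ}
    (hm : 0 < m) (i : ℕ) (x : G) (hx : x ∈ Subgroup.upperCentralSeries G (i + 1))
    (hxm : x ^ m ∈ Subgroup.upperCentralSeries G i) : x ∈ Subgroup.upperCentralSeries G i := by
  induction i generalizing x with
  | zero =>
    rw [Subgroup.upperCentralSeries_zero, mem_bot] at hxm ⊢
    by_contra h
    exact hG x h (isOfFinOrder_iff_pow_eq_one.2 ⟨m, hm, hxm⟩)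
  | succ i ih =>
    rw [Subgroup.mem_upperCentralSeries_succ_iff] at hx hxm ⊢
    intro g
    refine ih _ (hx g) ?_
    -- Modulo the `i`-th term the commutator is central, so `⁅x ^ m, g⁆ = ⁅x, g⁆ ^ m` there. The
    -- left side is trivial, which puts `⁅x, g⁆ ^ m` in the `i`-th term.
    have hc : QuotientGroup.mk' (Subgroup.upperCentralSeries G i) ⁅x, g⁆ ∈ center _ := by
      rw [mem_center_iff]
      intro q
      obtain ⟨y, rfl⟩ := QuotientGroup.mk'_surjective _ q
      have h1 := Subgroup.mem_upperCentralSeries_succ_iff.1 (hx g) y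
      rw [← QuotientGroup.eq_one_iff, ← QuotientGroup.mk'_apply, map_commutatorElement,
        commutatorElement_eq_one_iff_mul_comm] at h1
      exact h1.symm
    rw [map_commutatorElement] at hc
    have h2 := pow_commutator_of_mem_center hc m
    have h3 := hxm g
    rw [← QuotientGroup.eq_one_iff, ← QuotientGroup.mk'_apply, map_commutatorElement,
      map_pow] at h3
    rw [← QuotientGroup.eq_one_iff, ← QuotientGroup.mk'_apply, map_pow, map_commutatorElement,
      ← h2, h3]

/-- If a power of `x` is central, `x` descends the upper central series one term at a time, from the
top down to the centre. -/
lemma quotient_center_torsionFree [Group.IsNilpotent G] (hG : ∀ g : G, g ≠ 1 → ¬ IsOfFinOrder g)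
    (q : G ⧸ center G) (hq : q ≠ 1) : ¬ IsOfFinOrder q := by
  intro h
  obtain ⟨x, rfl⟩ := QuotientGroup.mk_surjective q
  obtain ⟨m, hm, hxm⟩ := isOfFinOrder_iff_pow_eq_one.1 h
  rw [← QuotientGroup.mk_pow, QuotientGroup.eq_one_iff] at hxm
  refine hq ((QuotientGroup.eq_one_iff x).2 ?_)
  rw [← Subgroup.upperCentralSeries_one] at hxm ⊢
  have key (i : ℕ) (hx : x ∈ Subgroup.upperCentralSeries G (i + 1)) : x ∈ Subgroup.upperCentralSeries G 1 := by
    induction i with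
    | zero => exact hx
    | succ i ih =>
      exact ih (mem_upperCentralSeries_of_pow_mem hG hm _ x hx
        (Subgroup.upperCentralSeries_mono G (by omega) hxm))
  obtain ⟨n, hn⟩ := Group.IsNilpotent.nilpotent G
  refine key n (Subgroup.upperCentralSeries_mono G (Nat.le_succ n) ?_)
  rw [hn]
  exact mem_top x

/-- Lifts of finitely many generators of the image generate `K` up to the kernel. -/
lemma exists_finite_map_closure {H : Type*} [Group H] (π : G →* H) (K : Subgroup G)
    (hK : (K.map π).FG) :
    ∃ S : Set G, S.Finite ∧ S ⊆ K ∧ K ≤ closure S ⊔ (K ⊓ π.ker) := by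
  obtain ⟨T, hT, hTf⟩ := (fg_iff _).1 hK
  have hsub : T ⊆ π '' K := by
    intro t ht
    have : t ∈ K.map π := hT ▸ subset_closure ht
    exact this
  obtain ⟨S, hSK, hSf, hST⟩ := Set.exists_subset_image_finite_and.1 ⟨T, hsub, hTf, rfl⟩
  refine ⟨S, hSf, hSK, fun x hx => ?_⟩
  have h1 : π x ∈ (closure S).map π := by
    rw [MonoidHom.map_closure, ← hST, hT]
    exact ⟨x, hx, rfl⟩
  obtain ⟨y, hy, hyx⟩ := h1
  have hyK : y ∈ K := (closure_le K).2 hSK hy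
  rw [← mul_inv_cancel_left y x]
  refine mul_mem_sup hy (mem_inf.2 ⟨mul_mem (inv_mem hyK) hx, ?_⟩)
  rw [MonoidHom.mem_ker, map_mul, map_inv, hyx, inv_mul_cancel]

lemma CommGroup.subgroup_fg {A : Type*} [CommGroup A] [Group.FG A] (H : Subgroup A) : H.FG := by
  have : Module.Finite ℤ (Additive A) := Module.Finite.iff_addGroup_fg.2 inferInstance
  rw [Subgroup.fg_iff_add_fg]
  have h : (AddSubgroup.toIntSubmodule (Subgroup.toAddSubgroup H)).FG := IsNoetherian.noetherian _
  rwa [Submodule.fg_iff_addSubgroup_fg, AddSubgroup.toIntSubmodule_toAddSubgroup] at h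

lemma fg_of_le_center {N H : Subgroup G} (hN : N ≤ center G) (hfg : N.FG) (hH : H ≤ N) : H.FG := by
  let _ : CommGroup N := { (inferInstance : Group N) with
    mul_comm := fun a b => Subtype.ext (mem_center_iff.1 (hN b.2) a) }
  have : Group.FG N := (Group.fg_iff_subgroup_fg N).2 hfg
  have h1 := CommGroup.subgroup_fg (H.subgroupOf N)
  obtain ⟨S, hS⟩ := h1
  rw [fg_iff]
  refine ⟨N.subtype '' S, ?_, S.finite_toSet.image _⟩
  rw [← MonoidHom.map_closure, hS, subgroupOf_map_subtype, inf_of_le_left hH]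

lemma normal_of_le_center {N : Subgroup G} (hN : N ≤ center G) : N.Normal :=
  ⟨fun n hn g => by rwa [mem_center_iff.1 (hN hn) g, mul_inv_cancel_right]⟩

/-- Subgroups of finitely generated nilpotent groups are finitely generated. -/
lemma fg_of_lowerCentralSeries_eq_bot (n : ℕ) : ∀ {G : Type u} [Group G] [Group.FG G],
    (⊤ : Subgroup G).lowerCentralSeries n = ⊥ → ∀ H : Subgroup G, H.FG := by
  induction n with
  | zero =>
    intro G _ _ h H
    have hH : H = ⊥ := le_bot_iff.1 (h ▸ le_top (a := H))
    exact hH ▸ FG.bot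
  | succ n ih =>
    intro G _ _ h H
    set L := (⊤ : Subgroup G).lowerCentralSeries n with hL
    have hLc : L ≤ center G := by
      rw [Subgroup.lowerCentralSeries_succ, commutator_eq_bot_iff_le_centralizer] at h
      rwa [coe_top, centralizer_univ] at h
    have hLn : L.Normal := normal_of_le_center hLc
    have hQ : (⊤ : Subgroup (G ⧸ L)).lowerCentralSeries n = ⊥ := by
      rw [← map_top_of_surjective _ (QuotientGroup.mk'_surjective L), ← map_lowerCentralSeries,
        ← hL, (map_eq_bot_iff L).2 (by rw [QuotientGroup.ker_mk'])]
    -- The last nontrivial term `L` is generated by the commutators of lifts `t` of generators of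
    -- the preceding term modulo `L` with generators `s` of `G`. Modulo the subgroup `D` of these,
    -- `t` is central, hence so is the whole preceding term, and `L ≤ D`.
    have hLfg : L.FG := by
      match n with
      | 0 => exact hL ▸ Group.fg_def.1 inferInstance
      | n + 1 =>
        obtain ⟨t, htf, htK, ht⟩ := exists_finite_map_closure (QuotientGroup.mk' L)
          ((⊤ : Subgroup G).lowerCentralSeries n) (ih hQ _)
        obtain ⟨s, hs, hsf⟩ := Group.fg_iff.1 (inferInstance : Group.FG G)
        let D : Subgroup G := closure (Set.image2 (fun a g => ⁅a, g⁆) t s)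
        have hDL : D ≤ L := by
          rw [closure_le]
          rintro _ ⟨a, ha, g, -, rfl⟩
          change ⁅a, g⁆ ∈ L
          rw [hL]
          exact commutator_mem_commutator (htK ha) (mem_top g)
        have hDn : D.Normal := normal_of_le_center (hDL.trans hLc)
        suffices hle : L ≤ D from
          (le_antisymm hle hDL) ▸ (fg_iff _).2 ⟨_, rfl, htf.image2 _ hsf⟩
        have hC : (⊤ : Subgroup G).lowerCentralSeries n ≤
            (center (G ⧸ D)).comap (QuotientGroup.mk' D) := by
          refine ht.trans (sup_le ((closure_le _).2 fun a ha => ?_) ?_)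
          · have hcent : closure s ≤ (centralizer {QuotientGroup.mk' D a}).comap
                (QuotientGroup.mk' D) := by
              rw [closure_le]
              intro g hg
              have h1 : ⁅a, g⁆ ∈ D := subset_closure ⟨a, ha, g, hg, rfl⟩
              rw [← QuotientGroup.eq_one_iff, ← QuotientGroup.mk'_apply, map_commutatorElement,
                commutatorElement_eq_one_iff_mul_comm] at h1
              change QuotientGroup.mk' D g ∈ centralizer _
              rw [mem_centralizer_singleton_iff]
              exact h1.symm
            change QuotientGroup.mk' D a ∈ center _
            rw [mem_center_iff]
            intro q
            obtain ⟨g, rfl⟩ := QuotientGroup.mk'_surjective D q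
            have : g ∈ closure s := hs ▸ mem_top g
            exact mem_centralizer_singleton_iff.1 (hcent this)
          · rintro a ⟨-, ha⟩
            rw [QuotientGroup.ker_mk'] at ha
            change QuotientGroup.mk' D a ∈ center _
            rw [mem_center_iff]
            intro q
            obtain ⟨g, rfl⟩ := QuotientGroup.mk'_surjective D q
            rw [← map_mul, ← map_mul, mem_center_iff.1 (hLc ha) g]
        rw [hL, Subgroup.lowerCentralSeries_succ, commutator_le]
        intro a ha g _
        rw [← QuotientGroup.eq_one_iff, ← QuotientGroup.mk'_apply, map_commutatorElement,
          commutatorElement_eq_one_iff_mul_comm]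
        exact (mem_center_iff.1 (hC ha) _).symm
    obtain ⟨S, hSf, hSH, hS⟩ := exists_finite_map_closure (QuotientGroup.mk' L) H (ih hQ _)
    rw [QuotientGroup.ker_mk'] at hS
    have hEq : H = closure S ⊔ (H ⊓ L) :=
      le_antisymm hS (sup_le ((closure_le H).2 hSH) inf_le_left)
    rw [hEq]
    exact ((fg_iff _).2 ⟨S, rfl, hSf⟩).sup (fg_of_le_center hLc hLfg inf_le_right)

lemma CommGroup.exists_mulEquiv_lattice (A : Type*) [CommGroup A] [Group.FG A]
    (hA : ∀ a : A, a ≠ 1 → ¬ IsOfFinOrder a) :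
    ∃ r : ℕ, Nonempty (A ≃* Multiplicative (Fin r → ℤ)) := by
  have : Module.Finite ℤ (Additive A) := Module.Finite.iff_addGroup_fg.2 inferInstance
  have : IsMulTorsionFree A := IsMulTorsionFree.of_not_isOfFinOrder hA
  have := Module.free_of_finite_type_torsion_free' (R := ℤ) (M := Additive A)
  let b := Module.finBasis ℤ (Additive A)
  exact ⟨_, ⟨AddEquiv.toMultiplicativeRight b.equivFun.toAddEquiv⟩⟩

/-- The centre of a finitely generated torsion-free nilpotent group is free abelian of finite
rank. -/
lemma exists_center_mulEquiv_lattice (G : Type u) [Group G] [Group.FG G] [Group.IsNilpotent G]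
    (hG : ∀ g : G, g ≠ 1 → ¬ IsOfFinOrder g) :
    ∃ r : ℕ, Nonempty (center G ≃* Multiplicative (Fin r → ℤ)) := by
  obtain ⟨n, hn⟩ := Subgroup.nilpotent_iff_lowerCentralSeries.1
    (inferInstance : Group.IsNilpotent G)
  have : Group.FG (center G) :=
    (Group.fg_iff_subgroup_fg _).2 (fg_of_lowerCentralSeries_eq_bot n hn _)
  let _ : CommGroup (center G) := { (inferInstance : Group (center G)) with
    mul_comm := fun a b => Subtype.ext (mem_center_iff.1 b.2 a) }
  refine CommGroup.exists_mulEquiv_lattice (center G) fun a ha h => ?_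
  exact hG a (fun h1 => ha (Subtype.ext h1)) 
    ((Submonoid.isOfFinOrder_coe (H := (center G).toSubmonoid)).2 h)

end NilpotentGroup

/-! ### Generation of `SL_n(ℤ)` by transvections. -/

section TransvectionGeneration

open Matrix

variable {ι : Type*} [Fintype ι] [DecidableEq ι]

lemma transvection_mul_coe_same {i j : ι} (hij : i ≠ j) (b : ℤ) (A : SpecialLinearGroup ι ℤ) (c : ι) :
    (SpecialLinearGroup.transvection hij b * A) i c = A i c + b * A j c :=
  Matrix.transvection_mul_apply_same i j c b A.1

lemma transvection_mul_coe_of_ne {i j : ι} (hij : i ≠ j) (b : ℤ) (A : SpecialLinearGroup ι ℤ) {a : ι} (ha : a ≠ i)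
    (c : ι) : (SpecialLinearGroup.transvection hij b * A) a c = A a c :=
  Matrix.transvection_mul_apply_of_ne i j a c ha b A.1

variable {N : Subgroup (SpecialLinearGroup ι ℤ)}

lemma exists_mem_mul_add_row
    (hN : ∀ (i j : ι) (hij : i ≠ j) (b : ℤ), SpecialLinearGroup.transvection hij b ∈ N)
    (j : ι) (v : ι → ℤ) (t : Finset ι) (hj : j ∉ t) :
    ∃ g ∈ N, ∀ (A : SpecialLinearGroup ι ℤ) (a c : ι), (g * A) a c = A a c + (if a ∈ t then v a else 0) * A j c := by
  induction t using Finset.induction_on with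
  | empty => exact ⟨1, N.one_mem, by simp⟩
  | insert i t hi ih =>
    rw [Finset.mem_insert, not_or] at hj
    obtain ⟨g, hg, h⟩ := ih hj.2
    have hij : i ≠ j := fun h => hj.1 h.symm
    refine ⟨SpecialLinearGroup.transvection hij (v i) * g, N.mul_mem (hN i j hij _) hg, ?_⟩
    intro A a c
    rw [mul_assoc]
    by_cases hai : a = i
    · subst hai
      rw [transvection_mul_coe_same, h, h, if_neg hi, if_neg hj.2]
      simp
    · rw [transvection_mul_coe_of_ne _ _ _ hai, h]
      simp [hai]

lemma mem_of_transvection_mul_mem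
    (hN : ∀ (i j : ι) (hij : i ≠ j) (b : ℤ), SpecialLinearGroup.transvection hij b ∈ N)
    {i j : ι} (hij : i ≠ j) (b : ℤ) {A : SpecialLinearGroup ι ℤ}
    (h : SpecialLinearGroup.transvection hij b * A ∈ N) : A ∈ N :=
  (N.mul_mem_cancel_left (hN i j hij b)).1 h

/-- One step of the reduction: if all matrices whose columns indexed by `insert j s` are standard
lie in `N`, then so do those whose columns indexed by `s` are standard. -/
lemma mem_of_columns_insert
    (hN : ∀ (i j : ι) (hij : i ≠ j) (b : ℤ), SpecialLinearGroup.transvection hij b ∈ N)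
    (s : Finset ι) (j : ι) (hj : j ∉ s)
    (H : ∀ A : SpecialLinearGroup ι ℤ, (∀ i ∈ insert j s, ∀ a, A a i = (1 : Matrix ι ι ℤ) a i) → A ∈ N)
    (A : SpecialLinearGroup ι ℤ) (hA : ∀ i ∈ s, ∀ a, A a i = (1 : Matrix ι ι ℤ) a i) : A ∈ N := by
  have hcol (A : SpecialLinearGroup ι ℤ) (hA : ∀ i ∈ s, ∀ a, A a i = (1 : Matrix ι ι ℤ) a i) {p q : ι} (hpq : p ≠ q)
      (hq : q ∉ s) (b : ℤ) : ∀ i ∈ s, ∀ a, (SpecialLinearGroup.transvection hpq b * A) a i =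
        (1 : Matrix ι ι ℤ) a i := by
    intro i hi a
    by_cases ha : a = p
    · subst ha
      rw [transvection_mul_coe_same, hA i hi, hA i hi, Matrix.one_apply_ne (i := q)
        (fun h => hq (h ▸ hi)), mul_zero, add_zero]
    · rw [transvection_mul_coe_of_ne _ _ _ ha, hA i hi]
  -- the case of a pivot equal to `1`
  have hone (A : SpecialLinearGroup ι ℤ) (hA : ∀ i ∈ s, ∀ a, A a i = (1 : Matrix ι ι ℤ) a i) (h1 : A j j = 1) :
      A ∈ N := by
    obtain ⟨g, hg, h⟩ := exists_mem_mul_add_row hN j (fun a => -A a j) (Finset.univ.erase j)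
      (by simp)
    refine (N.mul_mem_cancel_left hg).1 (H _ fun i hi a => ?_)
    rw [h]
    rcases Finset.mem_insert.1 hi with rfl | hi
    · by_cases ha : a = i
      · subst ha; simp [h1]
      · simp [ha, h1]
    · have hji : j ≠ i := fun h => hj (h ▸ hi)
      rw [hA i hi, hA i hi, Matrix.one_apply_ne hji, mul_zero, add_zero]
  induction hm : ∑ b ∈ sᶜ, (A b j).natAbs using Nat.strong_induction_on generalizing A with
  | _ m ih =>
  -- Euclid's algorithm in column `j` on the rows outside `s`: a division with remainder lowers the
  -- sum of absolute values. When none is possible, at most one of these entries is nonzero.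
  by_cases hex : ∃ b c, b ≠ c ∧ b ∉ s ∧ c ∉ s ∧ A c j ≠ 0 ∧ (A c j).natAbs ≤ (A b j).natAbs
  · obtain ⟨b, c, hbc, hb, hc, hc0, hle⟩ := hex
    refine mem_of_transvection_mul_mem hN hbc (-(A b j / A c j)) ?_
    refine ih _ ?_ _ (hcol A hA hbc hc _) rfl
    rw [← hm]
    refine Finset.sum_lt_sum (fun a _ => ?_) ⟨b, by simpa using hb, ?_⟩
    all_goals
      have hlt : (A b j + -(A b j / A c j) * A c j).natAbs < (A b j).natAbs := by
        have h1 : A b j + -(A b j / A c j) * A c j = A b j % A c j := by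
          rw [Int.emod_def]; ring
        rw [h1]
        have h2 := Int.emod_nonneg (A b j) hc0
        have h3 := Int.emod_lt_abs (A b j) hc0
        rw [Int.abs_eq_natAbs] at h3
        omega
    · by_cases ha : a = b
      · subst ha
        rw [transvection_mul_coe_same]
        exact hlt.le
      · rw [transvection_mul_coe_of_ne _ _ _ ha]
    · rw [transvection_mul_coe_same]
      exact hlt
  · push Not at hex
    have hzero (b c : ι) (hbc : b ≠ c) (hb : b ∉ s) (hc : c ∉ s) (hb0 : A b j ≠ 0) : A c j = 0 := by
      by_contra hc0
      have h1 := hex b c hbc hb hc hc0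
      have h2 := hex c b hbc.symm hc hb hb0
      omega
    -- Row `j` of the inverse vanishes on `s`, so this sum reduces to the one surviving entry of
    -- column `j` outside `s`, which is therefore a unit.
    have hinv : ∑ b, (A⁻¹ : SpecialLinearGroup ι ℤ) j b * A b j = 1 := by
      have h1 : (A⁻¹ * A : SpecialLinearGroup ι ℤ) j j = 1 := by simp
      exact (Matrix.mul_apply (M := (A⁻¹).1) (N := A.1)).symm.trans h1
    have hinv0 (i : ι) (hi : i ∈ s) : (A⁻¹ : SpecialLinearGroup ι ℤ) j i = 0 := by
      have h1 : (A⁻¹ * A : SpecialLinearGroup ι ℤ) j i = 0 := by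
        rw [inv_mul_cancel]
        exact Matrix.one_apply_ne (fun h => hj (h ▸ hi))
      replace h1 := (Matrix.mul_apply (M := (A⁻¹).1) (N := A.1)).symm.trans h1
      rw [Finset.sum_eq_single i (fun b _ hb => by rw [hA i hi, Matrix.one_apply_ne hb, mul_zero])
        (by simp), hA i hi, Matrix.one_apply_eq, mul_one] at h1
      exact h1
    obtain ⟨b, hb, hb0⟩ : ∃ b, b ∉ s ∧ A b j ≠ 0 := by
      by_contra! h
      rw [Finset.sum_eq_zero] at hinv
      · exact zero_ne_one hinv
      · intro b _
        by_cases hb : b ∈ s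
        · rw [hinv0 b hb, zero_mul]
        · rw [h b hb, mul_zero]
    have hd : A b j = 1 ∨ A b j = -1 := by
      rw [Finset.sum_eq_single b _ (by simp)] at hinv
      · exact Int.isUnit_iff.1 (IsUnit.of_mul_eq_one_right _ hinv)
      · intro c _ hc
        by_cases hcs : c ∈ s
        · rw [hinv0 c hcs, zero_mul]
        · rw [hzero b c hc.symm hb hcs hb0, mul_zero]
    by_cases hbj : b = j
    · subst hbj
      rcases hd with hd | hd
      · exact hone A hA hd
      by_cases hc : ∃ c, c ∉ s ∧ c ≠ b
      · obtain ⟨c, hc, hcb⟩ := hc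
        -- The entries at rows `b` and `c` go from `(-1, 0)` to `(-1, 1)` to `(1, 1)`.
        refine mem_of_transvection_mul_mem hN hcb (-1) ?_
        refine mem_of_transvection_mul_mem hN hcb.symm 2 ?_
        refine hone _ (hcol _ (hcol A hA hcb hj _) hcb.symm hc _) ?_
        rw [transvection_mul_coe_same, transvection_mul_coe_of_ne _ _ _ hcb.symm,
          transvection_mul_coe_same, hd, hzero b c hcb.symm hb hc hb0]
        norm_num
      · exfalso
        push Not at hc
        -- With only column `b` left, clearing it yields a diagonal matrix with a single `-1`, of
        -- determinant `-1`.
        obtain ⟨g, -, h⟩ := exists_mem_mul_add_row hN b (fun a => A a b) (Finset.univ.erase b)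
          (by simp)
        have hdiag : ((g * A : SpecialLinearGroup ι ℤ) : Matrix ι ι ℤ) =
            Matrix.diagonal (Function.update 1 b (-1)) := by
          ext a c
          rw [h]
          by_cases hcb : c = b
          · subst hcb
            by_cases hac : a = c
            · subst hac; simp [hd]
            · simp [hac, hd]
          · have hcs : c ∈ s := by
              by_contra h
              exact hcb (hc c h)
            rw [hA c hcs, hA c hcs, Matrix.one_apply_ne (i := b) (fun h => hcb h.symm), mul_zero,
              add_zero]
            by_cases hac : a = c
            · subst hac; simp [hcb]
            · simp [hac]
        have hdet := (g * A).2
        rw [hdiag, Matrix.det_diagonal, Finset.prod_update_of_mem (Finset.mem_univ b)] at hdet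
        simp at hdet
    -- The pivot at `j` is zero, and adding `A b j` times row `b` makes it `(±1)² = 1`.
    · refine mem_of_transvection_mul_mem hN (Ne.symm hbj) (A b j) ?_
      refine hone _ (hcol A hA (Ne.symm hbj) hb _) ?_
      rw [transvection_mul_coe_same, hzero b j hbj hb hj hb0]
      rcases hd with hd | hd <;> rw [hd] <;> norm_num

/-- The group `SL_n(ℤ)` is generated by the elementary transvections. -/
theorem eq_top_of_transvection_mem
    (hN : ∀ (i j : ι) (hij : i ≠ j) (b : ℤ), SpecialLinearGroup.transvection hij b ∈ N) :
    N = ⊤ := by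
  have key (s : Finset ι) : ∀ A : SpecialLinearGroup ι ℤ, (∀ i ∈ sᶜ, ∀ a, A a i = (1 : Matrix ι ι ℤ) a i) →
      A ∈ N := by
    induction s using Finset.induction_on with
    | empty =>
      intro A hA
      have : A = 1 := by
        ext a i
        exact hA i (by simp) a
      rw [this]
      exact N.one_mem
    | insert j s hj ih =>
      refine mem_of_columns_insert hN _ j (by simp) ?_
      have : insert j (insert j s)ᶜ = sᶜ := by
        ext i
        by_cases hij : i = j
        · subst hij; simp [hj]
        · simp [hij]
      rwa [this]
  exact eq_top_iff.2 fun A _ => key Finset.univ A (by simp)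

end TransvectionGeneration

/-! ### Outer automorphisms and the induction along central quotients. -/

section OuterAutomorphisms

open Subgroup

variable {G : Type u} [Group G]

/-- The automorphism of `G ⧸ center G` induced by an automorphism of `G`. -/
def autQuotientCenter (G : Type u) [Group G] : MulAut G →* MulAut (G ⧸ center G) where
  toFun φ := QuotientGroup.congr (center G) (center G) φ
    (characteristic_iff_map_eq.1 inferInstance φ)
  map_one' := by
    ext q
    obtain ⟨g, rfl⟩ := QuotientGroup.mk_surjective q
    rfl
  map_mul' φ ψ := by
    ext q
    obtain ⟨g, rfl⟩ := QuotientGroup.mk_surjective q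
    rfl

@[simp]
lemma autQuotientCenter_mk (φ : MulAut G) (g : G) :
    autQuotientCenter G φ (g : G ⧸ center G) = (φ g : G ⧸ center G) := rfl

lemma autQuotientCenter_conj (g : G) :
    autQuotientCenter G (MulAut.conj g) = MulAut.conj (g : G ⧸ center G) := by
  ext q
  obtain ⟨x, rfl⟩ := QuotientGroup.mk_surjective q
  rfl

lemma characteristic_center_conj (g : G) :
    MulAut.characteristic (center G) (MulAut.conj g) = 1 := by
  ext z
  change g * z * g⁻¹ = z
  rw [mem_center_iff.1 z.2 g, mul_inv_cancel_right]

/-- The outer automorphism of `G ⧸ center G` induced by an outer automorphism of `G`. -/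
def outerAutQuotientCenter (G : Type u) [Group G] : OuterAut G →* OuterAut (G ⧸ center G) :=
  QuotientGroup.map _ _ (autQuotientCenter G) <| by
    rintro _ ⟨g, rfl⟩
    exact ⟨g, (autQuotientCenter_conj g).symm⟩

/-- The automorphism of the center of `G` induced by an outer automorphism of `G`. -/
def outerAutCenter (G : Type u) [Group G] : OuterAut G →* MulAut (center G) :=
  QuotientGroup.lift _ (MulAut.characteristic (center G)) <| by
    rintro _ ⟨g, rfl⟩
    exact characteristic_center_conj g

/-- A representative induces conjugation by some class on `G ⧸ center G`. Composing with the inverse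
conjugation by a lift makes that action trivial and leaves the action on the centre unchanged. -/
lemma exists_rep_of_outerAut_eq_one {o : OuterAut G} (h₁ : outerAutQuotientCenter G o = 1)
    (h₂ : outerAutCenter G o = 1) :
    ∃ φ : MulAut G, (φ : OuterAut G) = o ∧ (∀ g, ∃ z ∈ center G, φ g = g * z) ∧
      ∀ z ∈ center G, φ z = z := by
  obtain ⟨ψ, rfl⟩ := QuotientGroup.mk_surjective o
  obtain ⟨q, hq⟩ := (QuotientGroup.eq_one_iff (N := innerAut (G ⧸ center G)) _).1 h₁
  obtain ⟨x, rfl⟩ := QuotientGroup.mk_surjective q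
  rw [← autQuotientCenter_conj] at hq
  refine ⟨(MulAut.conj x)⁻¹ * ψ, ?_, fun g => ⟨g⁻¹ * ((MulAut.conj x)⁻¹ * ψ) g, ?_, by simp⟩,
    fun z hz => ?_⟩
  · have hx : (MulAut.conj x : OuterAut G) = 1 := (QuotientGroup.eq_one_iff _).2 ⟨x, rfl⟩
    rw [QuotientGroup.mk_mul, QuotientGroup.mk_inv, hx, inv_one, one_mul]
  · rw [← QuotientGroup.eq, ← autQuotientCenter_mk, map_mul, map_inv, hq, inv_mul_cancel]
    rfl
  · have h₃ : MulAut.characteristic (center G) ((MulAut.conj x)⁻¹ * ψ) = 1 := by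
      rw [map_mul, map_inv, characteristic_center_conj, inv_one, one_mul]
      exact h₂
    exact congrArg Subtype.val (DFunLike.congr_fun h₃ ⟨z, hz⟩)

/-- The chosen representatives multiply each `g` by central elements that both of them fix, so
composing in either order multiplies `g` by the same product. -/
lemma outerAut_commute_of_eq_one {o p : OuterAut G} (ho₁ : outerAutQuotientCenter G o = 1)
    (ho₂ : outerAutCenter G o = 1) (hp₁ : outerAutQuotientCenter G p = 1)
    (hp₂ : outerAutCenter G p = 1) : o * p = p * o := by
  obtain ⟨φ, rfl, hφ, hφz⟩ := exists_rep_of_outerAut_eq_one ho₁ ho₂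
  obtain ⟨ψ, rfl, hψ, hψz⟩ := exists_rep_of_outerAut_eq_one hp₁ hp₂
  rw [← QuotientGroup.mk_mul, ← QuotientGroup.mk_mul]
  congr 1
  ext g
  obtain ⟨y, hy, hφg⟩ := hφ g
  obtain ⟨z, hz, hψg⟩ := hψ g
  rw [MulAut.mul_apply, MulAut.mul_apply, hψg, hφg, map_mul, map_mul, hφg, hψg, hφz z hz, hψz y hy,
    mul_assoc, mul_assoc, mem_center_iff.1 hz y]

lemma SteinbergGroup.hom_outerAut_eq_one {n r : ℕ} (hn : 3 ≤ n) (hr : r < n)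
    (e : center G ≃* Multiplicative (Fin r → ℤ))
    (hQ : ∀ f : SteinbergGroup n ℤ →* OuterAut (G ⧸ center G), f = 1)
    (f : SteinbergGroup n ℤ →* OuterAut G) : f = 1 := by
  have h₁ (a) : outerAutQuotientCenter G (f a) = 1 :=
    DFunLike.congr_fun (hQ ((outerAutQuotientCenter G).comp f)) a
  have h₂ (a) : outerAutCenter G (f a) = 1 :=
    DFunLike.congr_fun (SteinbergGroup.hom_mulAut_eq_one hn hr e ((outerAutCenter G).comp f)) a
  exact SteinbergGroup.hom_eq_one_of_commute hn f fun a b =>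
    outerAut_commute_of_eq_one (h₁ a) (h₂ a) (h₁ b) (h₂ b)

/-- For a finitely generated torsion-free nilpotent group `G` there is a degree `h` (its Hirsch
length) in which the cohomology of `G` with coefficients in the group ring is nonzero, and such that
`St_n(ℤ)` has no nontrivial homomorphism to `Out(G)` for `n > h`. -/
theorem exists_regularExtNontrivial_and_hom_outerAut_eq_one (G : Type u) [Group G]
    [Group.IsNilpotent G] : Group.FG G → (∀ g : G, g ≠ 1 → ¬ IsOfFinOrder g) →
    ∃ h : ℕ, RegularExtNontrivial (ULift.{u} ℤ) G h ∧
      ∀ n, 3 ≤ n → h < n → ∀ f : SteinbergGroup n ℤ →* OuterAut G, f = 1 := by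
  have base (G : Type u) [Group G] [Subsingleton G] : ∃ h : ℕ,
      RegularExtNontrivial (ULift.{u} ℤ) G h ∧
        ∀ n, 3 ≤ n → h < n → ∀ f : SteinbergGroup n ℤ →* OuterAut G, f = 1 := by
    refine ⟨0, RegularExtNontrivial.zero_of_subsingleton, fun n _ _ f => ?_⟩
    ext a
    obtain ⟨φ, hφ⟩ := QuotientGroup.mk_surjective (f (PresentedGroup.of a))
    have : φ = 1 := by
      ext g
      exact Subsingleton.elim _ _
    rw [← hφ, this]
    rfl
  refine Group.nilpotent_center_quotient_ind (P := fun G [Group G] [Group.IsNilpotent G] =>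
    Group.FG G → (∀ g : G, g ≠ 1 → ¬ IsOfFinOrder g) →
    ∃ h : ℕ, RegularExtNontrivial (ULift.{u} ℤ) G h ∧
      ∀ n, 3 ≤ n → h < n → ∀ f : SteinbergGroup n ℤ →* OuterAut G, f = 1) G
    (fun G _ _ _ _ => base G) fun G _ _ ih hfg htf => ?_
  rcases subsingleton_or_nontrivial G with hG | hG
  · exact base G
  obtain ⟨h, hext, hhom⟩ := ih inferInstance (quotient_center_torsionFree htf)
  obtain ⟨r, ⟨e⟩⟩ := exists_center_mulEquiv_lattice G htf
  obtain _ | r := r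
  -- Rank zero would mean a trivial centre, impossible in a nontrivial nilpotent group.
  · refine absurd ((eq_bot_iff_forall _).2 fun z hz => ?_) (Group.IsNilpotent.center_ne_bot G)
    exact congrArg Subtype.val (e.injective (Subsingleton.elim (e ⟨z, hz⟩) (e 1)))
  have hrange : ((center G).subtype.comp e.symm.toMonoidHom).range = center G := by
    rw [MonoidHom.range_comp, MonoidHom.range_eq_top.2 e.symm.surjective, ← MonoidHom.range_eq_map,
      range_subtype]
  -- The degree grows by the rank of the centre, so `h + (r + 1) < n` bounds both the degree for the
  -- quotient and that rank below `n`.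
  refine ⟨h + (r + 1), hext.of_ker_eq_range r (QuotientGroup.mk' (center G))
    (QuotientGroup.mk'_surjective _) ((center G).subtype.comp e.symm.toMonoidHom)
    ((center G).subtype_injective.comp e.symm.injective) ?_ hrange.le, fun n hn hlt => ?_⟩
  · rw [QuotientGroup.ker_mk', hrange]
  · exact SteinbergGroup.hom_outerAut_eq_one hn (by omega) e (hhom n hn (by omega))

lemma HasCohomologicalDimension.le_of_regularExtNontrivial {k h : ℕ}
    (hk : HasCohomologicalDimension G k) (hh : RegularExtNontrivial (ULift.{u} ℤ) G h) : h ≤ k := by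
  by_contra! hlt
  obtain _ | m := h
  · omega
  exact not_nontrivial_iff_subsingleton.2
    (groupCohomology_subsingleton_ext _ m (hk.1 (Rep.free (ULift.{u} ℤ) G PUnit.{u + 1}) _ hlt)) hh

end OuterAutomorphisms

/-! ### From the Steinberg group to `SL_n(ℤ)`. -/

section SteinbergToSpecialLinear

open Matrix

variable {n : ℕ} {R : Type v} [CommRing R]

lemma Matrix.SpecialLinearGroup.transvection_mul_transvection {i j l : Fin n} (hij : i ≠ j)
    (hjl : j ≠ l) (hil : i ≠ l) (r s : R) :
    transvection hij r * transvection hjl s =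
      transvection hil (r * s) * transvection hjl s * transvection hij r :=
  Subtype.ext <| by
    simp [transvection_coe, mul_add, add_mul, hjl.symm, hil.symm]
    abel

lemma Matrix.SpecialLinearGroup.transvection_mul_transvection_of_ne {i j p q : Fin n} (hij : i ≠ j)
    (hpq : p ≠ q) (hjp : j ≠ p) (hiq : i ≠ q) (r s : R) :
    transvection hij r * transvection hpq s = transvection hpq s * transvection hij r :=
  Subtype.ext <| by
    simp [transvection_coe, mul_add, add_mul, hjp, hiq.symm]
    abel

/-- The homomorphism `St_n(R) → SL_n(R)` sending `x_{ij}(r)` to an elementary transvection. -/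
def SteinbergGroup.toSpecialLinearGroup (n : ℕ) (R : Type v) [CommRing R] :
    SteinbergGroup n R →* SpecialLinearGroup (Fin n) R :=
  PresentedGroup.toGroup (f := fun p => SpecialLinearGroup.transvection p.1.2 p.2) <| by
    rintro _ (⟨i, j, hij, r, s⟩ | ⟨i, j, l, hij, hjl, hil, r, s⟩ | ⟨i, j, p, q, hij, hpq, hjp, hiq, r, s⟩)
    · simp only [map_mul, map_inv, FreeGroup.lift_apply_of]
      rw [SpecialLinearGroup.transvection_add, mul_inv_cancel]
    · simp only [map_mul, map_inv, FreeGroup.lift_apply_of]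
      rw [SpecialLinearGroup.transvection_mul_transvection hij hjl hil]
      group
    · simp only [map_mul, map_inv, FreeGroup.lift_apply_of]
      rw [SpecialLinearGroup.transvection_mul_transvection_of_ne hij hpq hjp hiq]
      group

lemma SteinbergGroup.toSpecialLinearGroup_x {i j : Fin n} (hij : i ≠ j) (r : R) :
    toSpecialLinearGroup n R (x i j hij r) = SpecialLinearGroup.transvection hij r :=
  PresentedGroup.toGroup.of _

/-- Pulled back to the Steinberg group `f` is trivial, so its kernel contains the transvections,
which generate. -/
lemma hom_specialLinearGroup_eq_one {H : Type*} [Group H]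
    (hH : ∀ f : SteinbergGroup n ℤ →* H, f = 1) (f : SpecialLinearGroup (Fin n) ℤ →* H) :
    f = 1 := by
  refine MonoidHom.ker_eq_top_iff.1 (eq_top_of_transvection_mem fun i j hij b => ?_)
  rw [MonoidHom.mem_ker, ← SteinbergGroup.toSpecialLinearGroup_x]
  exact DFunLike.congr_fun (hH (f.comp (SteinbergGroup.toSpecialLinearGroup n ℤ))) _

end SteinbergToSpecialLinear

theorem mainTheorem7 (G : Type u) [Group G] [Group.FG G] [Group.IsNilpotent G]
    (hG : ∀ g : G, g ≠ 1 → ¬ IsOfFinOrder g)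
    (k n : ℕ) (hn : 3 ≤ n) (hk : HasCohomologicalDimension G k) (hkn : k < n) :
    (∀ f : SteinbergGroup n ℤ →* OuterAut G, f = 1) ∧
      (∀ f : Matrix.SpecialLinearGroup (Fin n) ℤ →* OuterAut G, f = 1) := by
  obtain ⟨h, hext, hhom⟩ := exists_regularExtNontrivial_and_hom_outerAut_eq_one G inferInstance hG
  have hSt := hhom n hn ((hk.le_of_regularExtNontrivial hext).trans_lt hkn)
  exact ⟨hSt, hom_specialLinearGroup_eq_one hSt⟩
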